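/- **Setting.** Let $(X,d)$ be a complete separable metric space with a non-negative Borel measure $m$ that is finite on bounded sets. *Weak upper gradients.* A test plan is a Borel probability measure $\pi$ on $C([0,1];X)$, concentrated on $AC^2$ curves, with $(e_s)_\#\pi\le Cm$ for some constant $C$ and all $s\in[0,1]$ (where $e_s(\gamma)=\gamma_s$), and with $\iint_0^1|\dot\gamma_s|^2\,ds\,d\pi(\gamma)<\infty$. A Borel function $G:X\to[0,\infty]$ is a weak upper gradient of $f:X\to\mathbb R$ if for every test plan $\pi$ and $\pi$-a.e. $\gamma$ one has $|f(\gamma_1)-f(\gamma_0)|\le\int_0^1G(\gamma_s)|\dot\gamma_s|\,ds<\infty$. The minimal weak upper gradient $|Df|$ is the $m$-a.e. smallest weak upper gradient of $f$, if $f$ has one. *Heat flow.* The Cheeger energy $E:L^2(m)\to[0,\infty]$ is $E(f)=\frac12\int|Df|^2\,dm$ if $f$ has a weak upper gradient in $L^2(m)$, and $E(f)=\infty$ otherwise. For $f\in L^2(m)$, the heat flow $t\mapsto h_tf$ is the $L^2(m)$-gradient flow of $E$ from $f$, that is, the unique curve that is continuous on $[0,\infty)$, locally absolutely continuous on $(0,\infty)$,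 equal to $f$ at $t=0$, and satisfies $-\frac{d}{dt}h_tf\in\partial E(h_tf)$ for a.e. $t>0$. *Heat kernel.* Assume that there are functions $r_t[x](y)\in(0,\infty)$, for $t>0$ and $x,y\in X$, such that each $r_t[x]$ is a probability density with respect to $m$ and, for all $t>0$ and $f\in L^2(m)$, $$h_tf(x)=\int f(y)\,r_t[x](y)\,dm(y)\qquad\text{for }m\text{-a.e. }x .$$ From now on $h_tf(x)$ denotes this integral, for every $x\in X$ and also for functions $f$ outside $L^2(m)$. *Harnack inequality.* Assume finally that for some $K\in\mathbb R$, all $p\in(1,\infty)$, $t>0$, $x,y\in X$ and $f\in L^1\cap L^\infty(m)$, $$|h_tf(x)|^p\le h_t(|f|^p)(y)\,\exp\Big(\frac{p\,K\,d^2(x,y)}{2(p-1)(e^{2Kt}-1)}\Big).$$ For $K=0$ the quotient $\frac{2K}{e^{2Kt}-1}$ is read as $\frac1t$, here and below. **Proposition.** Let $t>0$. Put $0\log0=0$, and for $g:X\to\mathbb R$ let $\operatorname{lip}g(x)=\limsup_{y\to x,\,y\ne x}\frac{|g(x)-g(y)|}{d(x,y)}$, with value $0$ at isolated points. 1. For every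 $f\in L^\infty(m)$ the function $h_tf$ is Lipschitz on $X$. 2. For every $f\in L^\infty(m)$ with $f\ge0$ $m$-a.e., at every point of $X$, $$\operatorname{lip}(h_tf)^2\le\frac{2K}{e^{2Kt}-1}\,h_tf\,\big(h_t(f\log f)-h_tf\,\log h_tf\big).$$ 3. For every $p\in(1,\infty)$ and every $f\in L^p(m)$ with $f\ge0$ $m$-a.e., the integrals defining $h_tf$ and $h_t(f\log f)$ converge absolutely at $m$-a.e. point, the minimal weak upper gradient $|Dh_tf|$ exists, and $$|Dh_tf|^2\le\frac{2K}{e^{2Kt}-1}\,h_tf\,\big(h_t(f\log f)-h_tf\,\log h_tf\big)\qquad m\text{-a.e.}$$ -/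

import Mathlib

open MeasureTheory Set Filter Topology
open scoped ENNReal NNReal unitInterval

namespace HeatMMS

noncomputable section

/-! ### Local Lipschitz constant and metric speed -/

/-- The local Lipschitz constant `limsup_{y → x, y ≠ x} d(f y, f x) / d(y, x)`, with values in
`[0, ∞]`; at an isolated point the filter is trivial and the value is `0`. -/
def lip {X Y : Type*} [PseudoEMetricSpace X] [PseudoEMetricSpace Y] (f : X → Y) (x : X) : ℝ≥0∞ :=
  limsup (fun y => edist (f y) (f x) / edist y x) (𝓝[≠] x)

/-- The metric speed `|γ'_t|` of a curve `γ : [0,1] → X`. For an absolutely continuous curve the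
upper limit is a limit at almost every `t`. -/
def speed {X : Type*} [PseudoEMetricSpace X] (γ : C(I, X)) (t : I) : ℝ≥0∞ :=
  lip (fun s => γ s) t

/-- `γ` belongs to `AC²([0,1]; X)`: there is `g ∈ L²(0,1)` with
`d(γ_s, γ_t) ≤ ∫_s^t g` for all `s ≤ t`. -/
def IsACCurve {X : Type*} [PseudoEMetricSpace X] (γ : C(I, X)) : Prop :=
  ∃ g : I → ℝ≥0∞, Measurable g ∧ ∫⁻ t, g t ^ 2 < ∞ ∧
    ∀ s t : I, s ≤ t → edist (γ s) (γ t) ≤ ∫⁻ τ in Icc s t, g τ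

/-! ### Weak upper gradients -/

/-- Borel σ-algebra on the space of curves (with the topology of uniform convergence). -/
instance curveMeasurableSpace {X : Type*} [TopologicalSpace X] : MeasurableSpace C(I, X) :=
  borel _

/-- The line integral `∫_γ G = ∫_0^1 G(γ_t) |γ'_t| dt`. -/
def lineIntegral {X : Type*} [PseudoEMetricSpace X] (G : X → ℝ≥0∞) (γ : C(I, X)) : ℝ≥0∞ :=
  ∫⁻ t : I, G (γ t) * speed γ t

/-- Test plans: Borel probability measures `π` on `C([0,1]; X)`, concentrated on `AC²` curves, with
`(e_t)_# π ≤ C m` for all `t` and with finite kinetic energy `∫∫ |γ'_t|² dt dπ(γ) < ∞`. -/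
structure IsTestPlan {X : Type*} [PseudoEMetricSpace X] [MeasurableSpace X] (m : Measure X)
    (π : Measure C(I, X)) : Prop where
  prob : IsProbabilityMeasure π
  ac : ∀ᵐ γ ∂π, IsACCurve γ
  compression : ∃ C : ℝ≥0, ∀ t : I, π.map (fun γ => γ t) ≤ C • m
  energy : ∫⁻ γ, (∫⁻ t : I, speed γ t ^ 2) ∂π < ∞

/-- `G : X → [0, ∞]` is a weak upper gradient of `f`: for every test plan and almost every curve,
`|f(γ_1) - f(γ_0)| ≤ ∫_γ G < ∞`. -/
def IsWeakUpperGradient {X : Type*} [PseudoEMetricSpace X] [MeasurableSpace X] (m : Measure X)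
    (f : X → ℝ) (G : X → ℝ≥0∞) : Prop :=
  Measurable G ∧ ∀ π : Measure C(I, X), IsTestPlan m π →
    ∀ᵐ γ ∂π, edist (f (γ 1)) (f (γ 0)) ≤ lineIntegral G γ ∧ lineIntegral G γ < ∞

/-- `G` is the `m`-a.e. smallest weak upper gradient of `f`. -/
def IsMinimalWeakUpperGradient {X : Type*} [PseudoEMetricSpace X] [MeasurableSpace X]
    (m : Measure X) (f : X → ℝ) (G : X → ℝ≥0∞) : Prop :=
  IsWeakUpperGradient m f G ∧ ∀ G' : X → ℝ≥0∞, IsWeakUpperGradient m f G' → G ≤ᵐ[m] G'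

open Classical in
/-- The minimal weak upper gradient `|D f|` (unique up to `m`-null sets); by convention it is `∞`
if `f` has no weak upper gradient. -/
def minWeakUpperGradient {X : Type*} [PseudoEMetricSpace X] [MeasurableSpace X]
    (m : Measure X) (f : X → ℝ) : X → ℝ≥0∞ :=
  if h : ∃ G, IsMinimalWeakUpperGradient m f G then h.choose else fun _ => ∞

/-- The Cheeger energy on `L²(m)`: it is `½ ∫ |D f|² dm` if `|D f|` exists and lies in `L²(m)`,
that is for `f ∈ W^{1,2}`, and `∞` otherwise. -/
def cheegerEnergy {X : Type*} [PseudoEMetricSpace X] [MeasurableSpace X] (m : Measure X)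
    (f : Lp ℝ 2 m) : ℝ≥0∞ :=
  2⁻¹ * ∫⁻ x, minWeakUpperGradient m f x ^ 2 ∂m

/-! ### Gradient flows and the heat flow -/

/-- The subdifferential of a functional `E : H → [0, ∞]` at `u`; it is empty where `E u = ∞`. -/
def subdifferential {H : Type*} [NormedAddCommGroup H] [InnerProductSpace ℝ H] (E : H → ℝ≥0∞)
    (u : H) : Set H :=
  {ξ | E u ≠ ∞ ∧ ∀ v, E v ≠ ∞ → (E u).toReal + inner ℝ ξ (v - u) ≤ (E v).toReal}

/-- `u : [0, ∞) → H` is the gradient flow of `E` from `f`: it is continuous on `[0, ∞)` with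
`u 0 = f`, locally absolutely continuous on `(0, ∞)`, and `-u'(t) ∈ ∂E(u(t))` for a.e. `t > 0`.
(The values of `u` at negative times play no role.) -/
structure IsGradientFlow {H : Type*} [NormedAddCommGroup H] [InnerProductSpace ℝ H]
    (E : H → ℝ≥0∞) (f : H) (u : ℝ → H) : Prop where
  init : u 0 = f
  cont : ContinuousOn u (Ici 0)
  ac : ∀ a b : ℝ, 0 < a → a ≤ b → AbsolutelyContinuousOnInterval u a b
  sol : ∀ᵐ t : ℝ, 0 < t → ∃ ξ ∈ subdifferential E (u t), HasDerivAt u (-ξ) t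

open Classical in
/-- The heat flow `t ↦ h_t f` on `L²(m)`: the gradient flow of the Cheeger energy from `f`.
It exists and is unique for every `f`, because the energy is convex and lower semicontinuous with
dense domain; the value `0` in the other case is a mere convention. -/
def heatFlow {X : Type*} [PseudoEMetricSpace X] [MeasurableSpace X] (m : Measure X) (t : ℝ)
    (f : Lp ℝ 2 m) : Lp ℝ 2 m :=
  if h : ∃ u, IsGradientFlow (cheegerEnergy m) f u then h.choose t else 0

/-! ### Heat kernel and dimension-free Harnack inequality -/

/-- The integral operator `f ↦ ∫ f(y) r_t[x](y) dm(y)` of a kernel `r`, where `r t x y` stands for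
`r_t[x](y)`. For the heat kernel this is the everywhere defined version of `h_t f`, and the
extension of `h_t` beyond `L²`. -/
def kernelFlow {X : Type*} [MeasurableSpace X] (m : Measure X) (r : ℝ → X → X → ℝ) (t : ℝ)
    (f : X → ℝ) (x : X) : ℝ :=
  ∫ y, f y * r t x y ∂m

/-- `r` is a heat kernel: for `t > 0`, `r_t[x]` is a positive probability density for every `x`,
and it represents the heat flow on `L²(m)`. -/
structure IsHeatKernel {X : Type*} [PseudoEMetricSpace X] [MeasurableSpace X] (m : Measure X)
    (r : ℝ → X → X → ℝ) : Prop where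
  pos : ∀ t, 0 < t → ∀ x y, 0 < r t x y
  integrable : ∀ t, 0 < t → ∀ x, Integrable (r t x) m
  integral_eq_one : ∀ t, 0 < t → ∀ x, ∫ y, r t x y ∂m = 1
  represents : ∀ t, 0 < t → ∀ f : Lp ℝ 2 m, heatFlow m t f =ᵐ[m] kernelFlow m r t f

/-- The factor `2K / (e^{2Kt} - 1)`, read as its limit `1 / t` for `K = 0`. -/
def rate (K t : ℝ) : ℝ :=
  if K = 0 then 1 / t else 2 * K / (Real.exp (2 * K * t) - 1)

/-- The dimension-free Harnack inequality
`|h_t f(x)|^p ≤ h_t(|f|^p)(y) exp(p K d²(x,y) / (2 (p-1) (e^{2Kt} - 1)))`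
for `p ∈ (1, ∞)`, `t > 0`, `x, y ∈ X` and `f ∈ L¹ ∩ L^∞`. -/
def DimFreeHarnack {X : Type*} [PseudoMetricSpace X] [MeasurableSpace X] (m : Measure X)
    (r : ℝ → X → X → ℝ) (K : ℝ) : Prop :=
  ∀ p : ℝ, 1 < p → ∀ t : ℝ, 0 < t → ∀ f : X → ℝ, MemLp f 1 m → MemLp f ∞ m → ∀ x y : X,
    |kernelFlow m r t f x| ^ p ≤
      kernelFlow m r t (fun z => |f z| ^ p) y *
        Real.exp (p * rate K t * dist x y ^ 2 / (4 * (p - 1)))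

/-- The right-hand side of the local logarithmic Sobolev inequality,
`2K / (e^{2Kt} - 1) · h_t f · (h_t(f log f) - h_t f log h_t f)`, with `0 log 0 = 0`. -/
def logSobolevBound {X : Type*} [MeasurableSpace X] (m : Measure X) (r : ℝ → X → X → ℝ)
    (K t : ℝ) (f : X → ℝ) (x : X) : ℝ :=
  rate K t * kernelFlow m r t f x *
    (kernelFlow m r t (fun y => f y * Real.log (f y)) x -
      kernelFlow m r t f x * Real.log (kernelFlow m r t f x))

end

end HeatMMS

open HeatMMS

/-
The measures `μ_x = r_t[x] m` are equivalent probability measures, so the Harnack inequality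
passes to all non-negative measurable functions by monotone limits. In terms of
`Λ_x(p) = log ∫ f^p dμ_x`, which is convex in `p`, it reads
`p Λ_x(1) ≤ Λ_y(p) + p κ d(x,y)² / (4 (p - 1))` with `κ = 2K / (e^{2Kt} - 1)`. The choice
`p - 1 = α d(x,y)` turns this into a bound on the difference quotients of `x ↦ Λ_x(1)`. As `y → x`
the bound becomes `α b + κ / (4 α)`, where `b = Λ_x'(1) - Λ_x(1)` is the normalized entropy of `f`
with respect to `μ_x`, and minimizing over `α` gives `lip(h_t f)² ≤ κ b (h_t f)²`.

For `f ∈ L^p` this needs `h_t(f^p)` to be finite at one point. It is, because the integral of the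
Huber function of `h_s g` decreases along the heat flow and controls `|h_s g|` in `L¹` on sets of
finite measure. Finally, the local Lipschitz constant of a function that is Lipschitz on bounded
sets is a weak upper gradient, and weak upper gradients are closed under minima and decreasing
limits, so that `|D h_t f|` exists and is at most `lip(h_t f)`.
-/

namespace HeatMMS

theorem absolutelyContinuousOnInterval_of_dist_le {Y Z : Type*} [PseudoMetricSpace Y]
    [PseudoMetricSpace Z] {f : ℝ → Y} {g : ℝ → Z} {a b C : ℝ}
    (hf : AbsolutelyContinuousOnInterval f a b)
    (h : ∀ s ∈ uIcc a b, ∀ t ∈ uIcc a b, dist (g s) (g t) ≤ C * dist (f s) (f t)) :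
    AbsolutelyContinuousOnInterval g a b := by
  have hlim : Tendsto (fun E : ℕ × (ℕ → ℝ × ℝ) =>
      C * ∑ i ∈ Finset.range E.1, dist (f (E.2 i).1) (f (E.2 i).2))
      (AbsolutelyContinuousOnInterval.totalLengthFilter ⊓
        𝓟 (AbsolutelyContinuousOnInterval.disjWithin a b)) (𝓝 0) := by
    simpa using Tendsto.const_mul C hf
  refine squeeze_zero' (Eventually.of_forall fun E => Finset.sum_nonneg fun i _ => dist_nonneg)
    ?_ hlim
  filter_upwards [mem_inf_of_right (mem_principal_self _)] with E hE
  rw [Finset.mul_sum]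
  exact Finset.sum_le_sum fun i hi => h _ (hE.1 i hi).1 _ (hE.1 i hi).2

theorem antitoneOn_of_ae_deriv_nonpos {φ : ℝ → ℝ} {c : ℝ}
    (hac : ∀ a b, c < a → a ≤ b → AbsolutelyContinuousOnInterval φ a b)
    (hderiv : ∀ᵐ x, c < x → deriv φ x ≤ 0) : AntitoneOn φ (Ioi c) := by
  intro a ha b _ hab
  have hint : ∫ x in a..b, deriv φ x ≤ 0 := by
    rw [intervalIntegral.integral_of_le hab]
    refine integral_nonpos_of_ae ((ae_restrict_iff' measurableSet_Ioc).2 ?_)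
    filter_upwards [hderiv] with x hx hxab using hx (lt_trans ha hxab.1)
  rw [(hac a b ha hab).integral_deriv_eq_sub] at hint
  linarith

section GradientFlow

variable {H : Type*} [NormedAddCommGroup H] [InnerProductSpace ℝ H]

/-- `T` is the metric projection onto its range, expressed by the variational inequality; the range
is not required to be closed or convex. -/
def IsMetricProjection (T : H → H) : Prop :=
  ∀ u v, inner ℝ (u - T u) (T v - T u) ≤ 0

/-- The Moreau envelope of the support function of the range of a metric projection `T`, also equal
to `½‖u‖² - ½‖u - T u‖²`. In `L²`, with `T` the truncation to `[-1, 1]`, it is the integral of the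
Huber function. -/
noncomputable def envelope (T : H → H) (u : H) : ℝ :=
  inner ℝ u (T u) - 2⁻¹ * ‖T u‖ ^ 2

namespace IsMetricProjection

variable {T : H → H}

theorem inner_le_envelope_sub (hT : IsMetricProjection T) (u v : H) :
    inner ℝ (T u) (v - u) ≤ envelope T v - envelope T u := by
  have hvu := hT v u
  have hsq := sq_nonneg ‖T v - T u‖
  rw [norm_sub_sq_real] at hsq
  simp only [inner_sub_left, inner_sub_right, real_inner_self_eq_norm_sq, envelope] at hvu ⊢
  linarith [real_inner_comm v (T u), real_inner_comm u (T u)]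

theorem envelope_sub_le (hT : IsMetricProjection T) (u v : H) :
    envelope T v - envelope T u ≤ inner ℝ (T u) (v - u) + 2⁻¹ * ‖v - u‖ ^ 2 := by
  have huv := hT u v
  have hsq := sq_nonneg ‖(v - u) - (T v - T u)‖
  rw [norm_sub_sq_real, norm_sub_sq_real (T v)] at hsq
  simp only [inner_sub_left, inner_sub_right, real_inner_self_eq_norm_sq, envelope] at huv hsq ⊢
  linarith [real_inner_comm v (T u), real_inner_comm u (T u), real_inner_comm (T v) (T u)]

theorem hasFDerivAt_envelope (hT : IsMetricProjection T) (w : H) :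
    HasFDerivAt (envelope T) (innerSL ℝ (T w)) w := by
  have hsmall : HasFDerivAt (fun v => envelope T v - envelope T w - inner ℝ (T w) (v - w))
      (0 : H →L[ℝ] ℝ) w := by
    refine Asymptotics.IsBigO.hasFDerivAt (n := 2) (.of_bound 1 (.of_forall fun v => ?_))
      (by norm_num)
    rw [Real.norm_eq_abs, abs_of_nonneg (sub_nonneg.2 (hT.inner_le_envelope_sub w v)), norm_pow,
      norm_norm]
    linarith [hT.envelope_sub_le w v, sq_nonneg ‖v - w‖]
  have hlin : HasFDerivAt (fun v => innerSL ℝ (T w) (v - w)) (innerSL ℝ (T w)) w :=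
    (innerSL ℝ (T w)).hasFDerivAt.comp w ((hasFDerivAt_id w).sub_const w)
  simpa using (hsmall.add hlin).add_const (envelope T w)

theorem dist_envelope_le (hT : IsMetricProjection T) {R : ℝ} {u v : H} (hu : ‖T u‖ ≤ R)
    (hv : ‖T v‖ ≤ R) : dist (envelope T u) (envelope T v) ≤ R * dist u v := by
  have hbound : ∀ x y : H, ‖T x‖ ≤ R → envelope T x - envelope T y ≤ R * dist x y := by
    intro x y hx
    have hxy := hT.inner_le_envelope_sub x y
    rw [← neg_sub x y, inner_neg_right] at hxy
    calc envelope T x - envelope T y ≤ inner ℝ (T x) (x - y) := by linarith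
      _ ≤ ‖T x‖ * ‖x - y‖ := real_inner_le_norm _ _
      _ ≤ R * dist x y := by rw [dist_eq_norm]; gcongr
  rw [Real.dist_eq, abs_sub_le_iff]
  exact ⟨hbound u v hu, dist_comm u v ▸ hbound v u hv⟩

theorem absolutelyContinuousOnInterval_envelope (hT : IsMetricProjection T)
    (hT0 : ∀ u, ‖T u‖ ≤ ‖u‖) {u : ℝ → H} {a b : ℝ} (hu : AbsolutelyContinuousOnInterval u a b) :
    AbsolutelyContinuousOnInterval (fun s => envelope T (u s)) a b := by
  obtain ⟨R, hR⟩ := hu.exists_bound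
  exact absolutelyContinuousOnInterval_of_dist_le hu fun s hs t ht =>
    hT.dist_envelope_le ((hT0 _).trans (hR s hs)) ((hT0 _).trans (hR t ht))

end IsMetricProjection

namespace IsGradientFlow

variable {E : H → ℝ≥0∞} {f : H} {u : ℝ → H} {T : H → H}

/-- Testing the subdifferential inclusion at `u t` with `u t - T (u t)` shows that the derivative
`-⟪T (u t), ξ⟫` of the envelope is at most `E (u t - T (u t)) - E (u t)`. -/
theorem ae_deriv_envelope_nonpos (hu : IsGradientFlow E f u) (hT : IsMetricProjection T)
    (hE : ∀ v, E (v - T v) ≤ E v) : ∀ᵐ t : ℝ, 0 < t → deriv (fun s => envelope T (u s)) t ≤ 0 := by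
  filter_upwards [hu.sol] with t hsol ht
  obtain ⟨ξ, ⟨hfin, hξ⟩, hderiv⟩ := hsol ht
  have hdec := ENNReal.toReal_mono hfin (hE (u t))
  have hsub := hξ (u t - T (u t)) (ne_top_of_le_ne_top hfin (hE (u t)))
  rw [sub_sub_cancel_left, inner_neg_right, real_inner_comm] at hsub
  have hchain : HasDerivAt (fun s => envelope T (u s)) (inner ℝ (T (u t)) (-ξ)) t :=
    (hT.hasFDerivAt_envelope (u t)).comp_hasDerivAt t hderiv
  rw [hchain.deriv, inner_neg_right]
  linarith

theorem envelope_le (hu : IsGradientFlow E f u) (hT : IsMetricProjection T)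
    (hT0 : ∀ u, ‖T u‖ ≤ ‖u‖) (hE : ∀ v, E (v - T v) ≤ E v) {t : ℝ} (ht : 0 < t) :
    envelope T (u t) ≤ envelope T f := by
  have hanti : AntitoneOn (fun s => envelope T (u s)) (Ioi 0) :=
    antitoneOn_of_ae_deriv_nonpos
      (fun a b ha hab => hT.absolutelyContinuousOnInterval_envelope hT0 (hu.ac a b ha hab))
      (hu.ae_deriv_envelope_nonpos hT hE)
  have hinit : Tendsto u (𝓝[>] 0) (𝓝 f) :=
    hu.init ▸ (hu.cont 0 self_mem_Ici).mono_left (nhdsWithin_mono _ Ioi_subset_Ici_self)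
  refine ge_of_tendsto ((hT.hasFDerivAt_envelope f).continuousAt.tendsto.comp hinit) ?_
  filter_upwards [Ioc_mem_nhdsGT ht] with s hs using hanti hs.1 ht hs.2

end IsGradientFlow

end GradientFlow

section Lip

theorem lip_eq_iInf_iSup {X Y : Type*} [PseudoEMetricSpace X] [PseudoEMetricSpace Y] (f : X → Y)
    (x : X) :
    lip f x = ⨅ n : ℕ, ⨆ y, ⨆ (_ : edist y x < (n + 1 : ℝ≥0∞)⁻¹ ∧ y ≠ x),
      edist (f y) (f x) / edist y x := by
  have hbasis : (𝓝[≠] x).HasBasis (fun _ : ℕ => True)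
      (fun n => {y | edist y x < (n + 1 : ℝ≥0∞)⁻¹ ∧ y ≠ x}) := by
    refine Metric.nhdsWithin_basis_eball.to_hasBasis ?_ ?_
    · intro ε hε
      obtain ⟨n, hn⟩ := ENNReal.exists_inv_nat_lt hε.ne'
      exact ⟨n, trivial, fun y hy =>
        ⟨hy.1.trans_le ((ENNReal.inv_le_inv.2 le_self_add).trans hn.le), hy.2⟩⟩
    · exact fun n _ => ⟨(n + 1 : ℝ≥0∞)⁻¹, by simp, fun y hy => hy⟩
  simp only [lip, hbasis.limsup_eq_iInf_iSup, iInf_true]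
  rfl

theorem measurable_lip_uncurry {Z X Y : Type*} [TopologicalSpace Z] [MeasurableSpace Z]
    [PseudoEMetricSpace X] [MeasurableSpace X] [OpensMeasurableSpace (Z × X)]
    [PseudoEMetricSpace Y] {f : Z → X → Y} (hf : Continuous fun p : Z × X => f p.1 p.2) :
    Measurable fun p : Z × X => lip (f p.1) p.2 := by
  simp only [lip_eq_iInf_iSup]
  refine Measurable.iInf fun n => LowerSemicontinuous.measurable fun p a ha => ?_
  simp only [lt_iSup_iff] at ha
  obtain ⟨y, ⟨hy, -⟩, hlt⟩ := ha
  have hnum : ContinuousAt (fun q : Z × X => edist (f q.1 y) (f q.1 q.2)) p :=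
    (Continuous.edist (hf.comp (by fun_prop : Continuous fun q : Z × X => (q.1, y)))
      hf).continuousAt
  have hden : ContinuousAt (fun q : Z × X => edist y q.2) p := by fun_prop
  have hne : edist y p.2 ≠ 0 := by
    intro h
    have hins : Inseparable (f p.1 y) (f p.1 p.2) :=
      (EMetric.inseparable_iff.2 h).map (hf.comp (by fun_prop : Continuous fun z => (p.1, z)))
    simp [EMetric.inseparable_iff.1 hins] at hlt
  have hquot : ContinuousAt (fun q : Z × X => edist (f q.1 y) (f q.1 q.2) / edist y q.2) p :=
    ENNReal.Tendsto.div hnum (Or.inr hne) hden (Or.inl (hy.trans_le le_top).ne)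
  filter_upwards [hden.eventually_lt_const hy, hden.eventually_ne hne,
    hquot.eventually_const_lt hlt] with q hclose hdist hquot
  simp only [lt_iSup_iff]
  exact ⟨y, ⟨hclose, fun h => hdist (h ▸ edist_self _)⟩, hquot⟩

theorem measurable_lip {X Y : Type*} [PseudoEMetricSpace X] [MeasurableSpace X] [BorelSpace X]
    [PseudoEMetricSpace Y] {f : X → Y} (hf : Continuous f) : Measurable (lip f) := by
  have hjoint : Measurable (fun p : Unit × X => lip f p.2) :=
    measurable_lip_uncurry (f := fun _ : Unit => f) (hf.comp continuous_snd)
  have hmk : Measurable (fun x : X => ((), x)) := measurable_prodMk_left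
  simpa only [Function.comp_def] using hjoint.comp hmk

theorem lip_le_of_eventually {X Y : Type*} [PseudoEMetricSpace X] [PseudoEMetricSpace Y]
    {f : X → Y} {x : X} {c : ℝ≥0∞} (h : ∀ᶠ y in 𝓝[≠] x, edist (f y) (f x) ≤ c * edist y x) :
    lip f x ≤ c :=
  limsup_le_of_le (h := h.mono fun _ hy => ENNReal.div_le_of_le_mul hy)

theorem lip_le_of_lipschitzOnWith {X Y : Type*} [PseudoEMetricSpace X] [PseudoEMetricSpace Y]
    {f : X → Y} {C : ℝ≥0} {s : Set X} (hf : LipschitzOnWith C f s) {x : X} (hx : s ∈ 𝓝 x) :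
    lip f x ≤ C := by
  refine lip_le_of_eventually (Eventually.filter_mono nhdsWithin_le_nhds ?_)
  filter_upwards [hx] with y hy using hf hy (mem_of_mem_nhds hx)

theorem eventually_edist_le_of_lip_lt {X Y : Type*} [PseudoMetricSpace X] [PseudoEMetricSpace Y]
    {f : X → Y} {x : X} {c : ℝ≥0∞} (h : lip f x < c) :
    ∀ᶠ y in 𝓝 x, edist (f y) (f x) ≤ c * edist y x := by
  have hquot : ∀ᶠ y in 𝓝[≠] x, edist (f y) (f x) / edist y x < c := eventually_lt_of_limsup_lt h
  rw [eventually_nhdsWithin_iff] at hquot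
  filter_upwards [hquot] with y hy
  by_cases hyx : y = x
  · simp [hyx]
  · have hle : edist (f y) (f x) ≤ edist (f y) (f x) / edist y x * edist y x :=
      (ENNReal.div_le_iff_le_mul (Or.inr (hy hyx).ne_top) (Or.inl (edist_ne_top y x))).1 le_rfl
    exact hle.trans (mul_le_mul_left (hy hyx).le _)

theorem lip_comp_le {X Y Z : Type*} [PseudoMetricSpace X] [PseudoMetricSpace Y]
    [PseudoEMetricSpace Z] {f : Y → Z} {g : X → Y} {x : X} (hg : ContinuousAt g x)
    (hf' : lip f (g x) ≠ ∞) (hg' : lip g x ≠ ∞) :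
    lip (fun y => f (g y)) x ≤ lip f (g x) * lip g x := by
  refine ENNReal.le_mul_of_forall_lt (Or.inr hg') (Or.inl hf') fun a ha b hb => ?_
  refine lip_le_of_eventually (Eventually.filter_mono nhdsWithin_le_nhds ?_)
  filter_upwards [hg.eventually (eventually_edist_le_of_lip_lt ha),
    eventually_edist_le_of_lip_lt hb] with y hfy hgy
  rw [mul_assoc]
  exact hfy.trans (mul_le_mul_right hgy _)

theorem lip_comp_le_of_lipschitzWith_one {X Y Z : Type*} [PseudoEMetricSpace X]
    [PseudoEMetricSpace Y] [PseudoEMetricSpace Z] {f : Y → Z} (hf : LipschitzWith 1 f) (g : X → Y)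
    (x : X) : lip (fun y => f (g y)) x ≤ lip g x :=
  limsup_le_limsup (Eventually.of_forall fun y =>
    ENNReal.div_le_div_right (by simpa using hf (g y) (g x)) _)

end Lip

section AffineMap

/-- The affine map `τ ↦ (t - s) τ + s` of the unit interval, which for `s < t` parametrises the
subinterval `[s, t]`; precomposition with it restricts a curve to `[s, t]`. -/
def affineMap (s t : I) : C(I, I) where
  toFun τ := ⟨(t - s) * τ + s, by
    constructor <;> nlinarith [τ.2.1, τ.2.2, s.2.1, s.2.2, t.2.1, t.2.2]⟩
  continuous_toFun := by fun_prop

theorem coe_affineMap (s t τ : I) : (affineMap s t τ : ℝ) = (t - s) * τ + s := rfl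

theorem affineMap_zero (s t : I) : affineMap s t 0 = s := by
  ext; simp [coe_affineMap]

theorem affineMap_one (s t : I) : affineMap s t 1 = t := by
  ext; simp [coe_affineMap]

theorem edist_affineMap {s t : I} (hst : s ≤ t) (a b : I) :
    edist (affineMap s t a) (affineMap s t b) = ENNReal.ofReal (t - s) * edist a b := by
  have hlen : (0 : ℝ) ≤ t - s := sub_nonneg.2 hst
  rw [edist_dist, edist_dist, ← ENNReal.ofReal_mul hlen, Subtype.dist_eq, Subtype.dist_eq,
    coe_affineMap, coe_affineMap, dist_add_right, Real.dist_eq, Real.dist_eq, ← mul_sub, abs_mul,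
    abs_of_nonneg hlen]

theorem affineMap_strictMono {s t : I} (hst : s < t) : StrictMono (affineMap s t) := by
  intro a b hab
  have hlen : (0 : ℝ) < t - s := sub_pos.2 hst
  change (t - s : ℝ) * a + s < (t - s) * b + s
  gcongr

theorem lintegral_unitInterval (h : I → ℝ≥0∞) :
    ∫⁻ τ, h τ = ∫⁻ x in Icc (0 : ℝ) 1, h (projIcc 0 1 zero_le_one x) := by
  rw [← lintegral_subtype_comap measurableSet_Icc]
  simp only [projIcc_val]
  rfl

theorem setLIntegral_unitInterval (h : I → ℝ≥0∞) (s t : I) :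
    ∫⁻ τ in Icc s t, h τ = ∫⁻ x in Icc (s : ℝ) t, h (projIcc 0 1 zero_le_one x) := by
  have hsub : Icc (s : ℝ) t ∩ Icc 0 1 = Icc (s : ℝ) t :=
    inter_eq_left.2 (Icc_subset_Icc s.2.1 t.2.2)
  rw [← hsub, ← Measure.restrict_restrict measurableSet_Icc,
    ← lintegral_indicator measurableSet_Icc, ← lintegral_indicator measurableSet_Icc,
    lintegral_unitInterval]
  refine setLIntegral_congr_fun measurableSet_Icc fun x hx => ?_
  simp only [indicator_apply, projIcc_of_mem _ hx]
  rfl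

theorem lintegral_affineMap {s t : I} (hst : s < t) (h : I → ℝ≥0∞) :
    ∫⁻ τ, ENNReal.ofReal (t - s) * h (affineMap s t τ) = ∫⁻ τ in Icc s t, h τ := by
  have hlen : (0 : ℝ) < t - s := sub_pos.2 hst
  have himage : (fun x : ℝ => ((t : ℝ) - s) * x + s) '' Icc 0 1 = Icc (s : ℝ) t := by
    rw [image_affine_Icc' hlen]
    simp
  have hderiv : ∀ x ∈ Icc (0 : ℝ) 1,
      HasDerivWithinAt (fun x : ℝ => ((t : ℝ) - s) * x + s) (t - s) (Icc 0 1) x := fun x _ => by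
    simpa using (((hasDerivAt_id x).const_mul ((t : ℝ) - s)).add_const (s : ℝ)).hasDerivWithinAt
  have hinj : InjOn (fun x : ℝ => ((t : ℝ) - s) * x + s) (Icc 0 1) := fun x _ y _ hxy =>
    mul_left_cancel₀ hlen.ne' (add_right_cancel hxy)
  rw [setLIntegral_unitInterval, lintegral_unitInterval, ← himage,
    lintegral_image_eq_lintegral_abs_deriv_mul measurableSet_Icc hderiv hinj]
  refine setLIntegral_congr_fun measurableSet_Icc fun x hx => ?_
  rw [abs_of_pos hlen, projIcc_of_mem _ hx]
  congr 2
  exact (projIcc_of_mem _ (affineMap s t ⟨x, hx⟩).2).symm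

theorem setLIntegral_affineMap {s t : I} (hst : s < t) (h : I → ℝ≥0∞) (a b : I) :
    ∫⁻ τ in Icc a b, ENNReal.ofReal (t - s) * h (affineMap s t τ)
      = ∫⁻ τ in Icc (affineMap s t a) (affineMap s t b), h τ := by
  have hmono := affineMap_strictMono hst
  have hsub : Icc (affineMap s t a) (affineMap s t b) ⊆ Icc s t :=
    Icc_subset_Icc ((affineMap_zero s t).ge.trans (hmono.monotone unitInterval.nonneg'))
      ((hmono.monotone unitInterval.le_one').trans (affineMap_one s t).le)
  rw [← inter_eq_left.2 hsub, ← Measure.restrict_restrict measurableSet_Icc,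
    ← lintegral_indicator measurableSet_Icc, ← lintegral_indicator measurableSet_Icc,
    ← lintegral_affineMap hst]
  refine lintegral_congr fun τ => ?_
  have hiff : affineMap s t τ ∈ Icc (affineMap s t a) (affineMap s t b) ↔ τ ∈ Icc a b := by
    rw [mem_Icc, mem_Icc, hmono.le_iff_le, hmono.le_iff_le]
  by_cases hτ : τ ∈ Icc a b
  · rw [indicator_of_mem hτ, indicator_of_mem (hiff.2 hτ)]
  · rw [indicator_of_notMem hτ, indicator_of_notMem (mt hiff.1 hτ), mul_zero]

end AffineMap

section Speed

instance {X : Type*} [TopologicalSpace X] : BorelSpace C(I, X) := ⟨rfl⟩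

theorem measurable_eval {X : Type*} [TopologicalSpace X] [MeasurableSpace X] [BorelSpace X]
    (t : I) : Measurable fun γ : C(I, X) => γ t :=
  (continuous_eval_const t).measurable

variable {X : Type*} [PseudoMetricSpace X]

theorem measurable_speed (γ : C(I, X)) : Measurable (speed γ) := measurable_lip γ.continuous

theorem measurable_speed_uncurry :
    Measurable (fun p : C(I, X) × I => speed p.1 p.2) :=
  measurable_lip_uncurry (f := fun (γ : C(I, X)) s => γ s) (by fun_prop)

theorem speed_comp_affineMap_le (γ : C(I, X)) {s t : I} (hst : s < t) (τ : I) :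
    speed (γ.comp (affineMap s t)) τ ≤ ENNReal.ofReal (t - s) * speed γ (affineMap s t τ) := by
  have hlen : ENNReal.ofReal ((t : ℝ) - s) ≠ 0 := by
    simpa using hst
  have htend : Tendsto (affineMap s t) (𝓝[≠] τ) (𝓝[≠] (affineMap s t τ)) := by
    refine tendsto_nhdsWithin_iff.2
      ⟨(affineMap s t).continuous.continuousAt.tendsto.mono_left nhdsWithin_le_nhds, ?_⟩
    filter_upwards [self_mem_nhdsWithin] with y hy
    exact (affineMap_strictMono hst).injective.ne hy
  have hlim : limsup (fun y => edist (γ (affineMap s t y)) (γ (affineMap s t τ)) /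
      edist (affineMap s t y) (affineMap s t τ)) (𝓝[≠] τ) ≤ speed γ (affineMap s t τ) :=
    limsup_le_limsup_of_le (u := fun z => edist (γ z) (γ (affineMap s t τ)) /
      edist z (affineMap s t τ)) htend
  refine le_trans (le_of_eq ?_) (mul_le_mul_right hlim _)
  rw [← ENNReal.limsup_const_mul_of_ne_top ENNReal.ofReal_ne_top]
  refine congrArg (limsup · _) (funext fun y => ?_)
  rw [edist_affineMap hst.le, ← mul_div_assoc]
  exact (ENNReal.mul_div_mul_left _ _ hlen ENNReal.ofReal_ne_top).symm

theorem lintegral_sq_affineMap_le {s t : I} (hst : s < t) (g : I → ℝ≥0∞) :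
    ∫⁻ τ, (ENNReal.ofReal (t - s) * g (affineMap s t τ)) ^ 2 ≤ ∫⁻ τ, g τ ^ 2 := by
  have hlen : ENNReal.ofReal ((t : ℝ) - s) ≤ 1 := by
    rw [ENNReal.ofReal_le_one]; linarith [t.2.2, s.2.1]
  calc ∫⁻ τ, (ENNReal.ofReal (t - s) * g (affineMap s t τ)) ^ 2
      ≤ ∫⁻ τ, ENNReal.ofReal (t - s) * g (affineMap s t τ) ^ 2 := by
        refine lintegral_mono fun τ => ?_
        rw [mul_pow]
        exact mul_le_mul_left (pow_le_of_le_one zero_le hlen two_ne_zero) _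
    _ = ∫⁻ τ in Icc s t, g τ ^ 2 := lintegral_affineMap hst fun x => g x ^ 2
    _ ≤ ∫⁻ τ, g τ ^ 2 := setLIntegral_le_lintegral _ _

theorem lintegral_speed_sq_comp_affineMap_le (γ : C(I, X)) {s t : I} (hst : s < t) :
    ∫⁻ τ, speed (γ.comp (affineMap s t)) τ ^ 2 ≤ ∫⁻ τ, speed γ τ ^ 2 :=
  (lintegral_mono fun τ => pow_le_pow_left' (speed_comp_affineMap_le γ hst τ) 2).trans
    (lintegral_sq_affineMap_le hst (speed γ))

theorem lineIntegral_comp_affineMap_le (G : X → ℝ≥0∞) (γ : C(I, X)) {s t : I} (hst : s < t) :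
    lineIntegral G (γ.comp (affineMap s t)) ≤ ∫⁻ τ in Icc s t, G (γ τ) * speed γ τ := by
  rw [← lintegral_affineMap hst]
  refine lintegral_mono fun τ => ?_
  rw [← mul_left_comm]
  exact mul_le_mul_right (speed_comp_affineMap_le γ hst τ) _

end Speed

section AbsolutelyContinuous

theorem lintegral_lt_top_of_lintegral_sq_lt_top {α : Type*} [MeasurableSpace α] {μ : Measure α}
    [IsFiniteMeasure μ] {g : α → ℝ≥0∞} (hg : ∫⁻ x, g x ^ 2 ∂μ < ∞) : ∫⁻ x, g x ∂μ < ∞ := by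
  calc ∫⁻ x, g x ∂μ ≤ ∫⁻ x, (1 + g x ^ 2) ∂μ := by
        refine lintegral_mono fun x => ?_
        rcases le_total (g x) 1 with h | h
        · exact h.trans le_self_add
        · exact (le_self_pow₀ h two_ne_zero).trans le_add_self
    _ = μ univ + ∫⁻ x, g x ^ 2 ∂μ := by
        rw [lintegral_add_left measurable_const, lintegral_const, one_mul]
    _ < ∞ := ENNReal.add_lt_top.2 ⟨measure_lt_top _ _, hg⟩

theorem absolutelyContinuousOnInterval_of_edist_le_setLIntegral {Y : Type*} [PseudoMetricSpace Y]
    {w : ℝ → Y} {g : ℝ → ℝ≥0∞} {a b : ℝ} (hab : a ≤ b) (hgm : Measurable g)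
    (hg : ∫⁻ x in Icc a b, g x ≠ ∞)
    (hw : ∀ s ∈ Icc a b, ∀ t ∈ Icc a b, s ≤ t → edist (w s) (w t) ≤ ∫⁻ x in Icc s t, g x) :
    AbsolutelyContinuousOnInterval w a b := by
  have hint : IntervalIntegrable (fun x => (g x).toReal) volume a b :=
    (intervalIntegrable_iff_integrableOn_Icc_of_le hab).2
      (integrable_toReal_of_lintegral_ne_top hgm.aemeasurable hg)
  have hle : ∀ s ∈ Icc a b, ∀ t ∈ Icc a b, s ≤ t → dist (w s) (w t) ≤
      dist (∫ x in a..s, (g x).toReal) (∫ x in a..t, (g x).toReal) := by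
    intro s hs t ht hst
    have hfin : ∫⁻ x in Icc s t, g x ≠ ∞ :=
      ne_top_of_le_ne_top hg (lintegral_mono_set (Icc_subset_Icc hs.1 ht.2))
    have hsub : ∀ x ∈ Icc a b, IntervalIntegrable (fun x => (g x).toReal) volume a x :=
      fun x hx => hint.mono_set (by
        rw [uIcc_of_le hx.1, uIcc_of_le hab]
        exact Icc_subset_Icc le_rfl hx.2)
    rw [dist_comm (∫ x in a..s, (g x).toReal), Real.dist_eq,
      intervalIntegral.integral_interval_sub_left (hsub t ht) (hsub s hs),
      intervalIntegral.integral_of_le hst, ← integral_Icc_eq_integral_Ioc,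
      integral_toReal hgm.aemeasurable (ae_lt_top hgm hfin), abs_of_nonneg ENNReal.toReal_nonneg,
      ← ENNReal.ofReal_le_iff_le_toReal hfin, ← edist_dist]
    exact hw s hs t ht hst
  refine absolutelyContinuousOnInterval_of_dist_le (C := 1)
    (hint.absolutelyContinuousOnInterval_intervalIntegral left_mem_uIcc) fun s hs t ht => ?_
  rw [uIcc_of_le hab] at hs ht
  rw [one_mul]
  rcases le_total s t with hst | hts
  · exact hle s hs t ht hst
  · rw [dist_comm, dist_comm (∫ x in a..s, (g x).toReal)]
    exact hle t ht s hs hts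

theorem enorm_deriv_le_lip (v : I → ℝ) (τ : I) :
    ‖deriv (fun x : ℝ => v (projIcc 0 1 zero_le_one x)) τ‖ₑ ≤ lip v τ := by
  set w : ℝ → ℝ := fun x => v (projIcc 0 1 zero_le_one x) with hw
  by_cases hd : DifferentiableAt ℝ w τ
  swap
  · simp [deriv_zero_of_not_differentiableAt hd]
  have hcoe : Tendsto (Subtype.val : I → ℝ) (𝓝[≠] τ) (𝓝[≠] (τ : ℝ)) :=
    tendsto_nhdsWithin_iff.2
      ⟨continuous_subtype_val.continuousAt.tendsto.mono_left nhdsWithin_le_nhds,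
        eventually_mem_nhdsWithin.mono fun y hy h => hy (Subtype.ext h)⟩
  have hquot : Tendsto (fun y : I => edist (v y) (v τ) / edist y τ) (𝓝[≠] τ)
      (𝓝 ‖deriv w τ‖ₑ) := by
    refine ((continuous_enorm.tendsto _).comp (hd.hasDerivAt.tendsto_slope.comp hcoe)).congr' ?_
    filter_upwards [self_mem_nhdsWithin] with y hy
    have hne : (y : ℝ) - τ ≠ 0 := sub_ne_zero.2 fun h => hy (Subtype.ext h)
    simp only [Function.comp_apply, slope_def_field, hw, projIcc_val]
    rw [div_eq_mul_inv, enorm_mul, enorm_inv hne, edist_eq_enorm_sub, ← div_eq_mul_inv,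
      Subtype.edist_eq, edist_eq_enorm_sub]
  have : (𝓝[≠] τ).NeBot := inferInstance
  exact hquot.limsup_eq.ge

theorem edist_le_setLIntegral_lip {v : I → ℝ}
    (hv : AbsolutelyContinuousOnInterval (fun x => v (projIcc 0 1 zero_le_one x)) 0 1) {s t : I}
    (hst : s ≤ t) : edist (v s) (v t) ≤ ∫⁻ τ in Icc s t, lip v τ := by
  have hst' : (s : ℝ) ≤ t := hst
  have hac : AbsolutelyContinuousOnInterval (fun x => v (projIcc 0 1 zero_le_one x)) s t := by
    refine hv.mono ?_
    rw [uIcc_of_le zero_le_one, uIcc_of_le hst']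
    exact Icc_subset_Icc s.2.1 t.2.2
  have hsub := hac.integral_deriv_eq_sub
  simp only [projIcc_val] at hsub
  rw [edist_comm, edist_eq_enorm_sub, ← hsub, intervalIntegral.integral_of_le hst',
    ← integral_Icc_eq_integral_Ioc, setLIntegral_unitInterval]
  refine (enorm_integral_le_lintegral_enorm _).trans (setLIntegral_mono' measurableSet_Icc ?_)
  intro x hx
  rw [projIcc_of_mem _ (Icc_subset_Icc s.2.1 t.2.2 hx)]
  exact enorm_deriv_le_lip v ⟨x, Icc_subset_Icc s.2.1 t.2.2 hx⟩

end AbsolutelyContinuous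

namespace IsACCurve

variable {X : Type*} [PseudoMetricSpace X] {γ : C(I, X)}

theorem absolutelyContinuousOnInterval (hγ : IsACCurve γ) :
    AbsolutelyContinuousOnInterval (fun x : ℝ => γ (projIcc 0 1 zero_le_one x)) 0 1 := by
  obtain ⟨g, hgm, hg2, hg⟩ := hγ
  refine absolutelyContinuousOnInterval_of_edist_le_setLIntegral zero_le_one
    (hgm.comp (continuous_projIcc (h := zero_le_one)).measurable) ?_ fun s hs t ht hst => ?_
  · simp only [Function.comp_apply, ← lintegral_unitInterval]
    exact (lintegral_lt_top_of_lintegral_sq_lt_top hg2).ne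
  · rw [projIcc_of_mem _ hs, projIcc_of_mem _ ht]
    exact (hg _ _ hst).trans (setLIntegral_unitInterval g _ _).le

theorem absolutelyContinuousOnInterval_comp (hγ : IsACCurve γ) {u : X → ℝ} {C : ℝ≥0}
    (hu : LipschitzOnWith C u (range γ)) :
    AbsolutelyContinuousOnInterval (fun x : ℝ => u (γ (projIcc 0 1 zero_le_one x))) 0 1 :=
  absolutelyContinuousOnInterval_of_dist_le hγ.absolutelyContinuousOnInterval fun _ _ _ _ =>
    hu.dist_le_mul _ (mem_range_self _) _ (mem_range_self _)

theorem edist_le_setLIntegral_speed (hγ : IsACCurve γ) {s t : I} (hst : s ≤ t) :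
    edist (γ s) (γ t) ≤ ∫⁻ τ in Icc s t, speed γ τ := by
  have hdist : LipschitzWith 1 (dist (γ s)) := LipschitzWith.dist_right (γ s)
  calc edist (γ s) (γ t) = edist (dist (γ s) (γ s)) (dist (γ s) (γ t)) := by
        rw [dist_self, edist_dist, edist_dist, dist_zero_left, Real.norm_of_nonneg dist_nonneg]
    _ ≤ ∫⁻ τ in Icc s t, lip (fun τ => dist (γ s) (γ τ)) τ :=
        edist_le_setLIntegral_lip (v := fun τ => dist (γ s) (γ τ))
          (hγ.absolutelyContinuousOnInterval_comp hdist.lipschitzOnWith) hst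
    _ ≤ ∫⁻ τ in Icc s t, speed γ τ :=
        lintegral_mono fun τ => lip_comp_le_of_lipschitzWith_one hdist γ τ

theorem comp_affineMap (hγ : IsACCurve γ) {s t : I} (hst : s < t) :
    IsACCurve (γ.comp (affineMap s t)) := by
  obtain ⟨g, hgm, hg2, hg⟩ := hγ
  refine ⟨fun τ => ENNReal.ofReal (t - s) * g (affineMap s t τ),
    (hgm.comp (affineMap s t).continuous.measurable).const_mul _,
    (lintegral_sq_affineMap_le hst g).trans_lt hg2, fun a b hab => ?_⟩
  rw [setLIntegral_affineMap hst]
  exact hg _ _ ((affineMap_strictMono hst).monotone hab)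

end IsACCurve

section MeasurableACCurve

variable {X : Type*} [PseudoMetricSpace X]

theorem isACCurve_of_dense {γ : C(I, X)} {D : Set I} (hD : Dense D)
    (hfin : ∫⁻ τ, speed γ τ ^ 2 < ∞)
    (hγ : ∀ s ∈ D, ∀ t ∈ D, s ≤ t → edist (γ s) (γ t) ≤ ∫⁻ τ in Icc s t, speed γ τ) :
    IsACCurve γ := by
  refine ⟨speed γ, measurable_speed γ, hfin, fun s t hst => ?_⟩
  rcases hst.eq_or_lt with rfl | hlt
  · simp
  have hclosed : IsClosed {p : I × I | edist (γ p.1) (γ p.2) ≤ ∫⁻ τ in Icc s t, speed γ τ} :=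
    isClosed_le (by fun_prop) continuous_const
  have hsub : (Ioo s t ∩ D) ×ˢ (Ioo s t ∩ D) ⊆
      {p : I × I | edist (γ p.1) (γ p.2) ≤ ∫⁻ τ in Icc s t, speed γ τ} := by
    rintro ⟨a, b⟩ ⟨⟨ha, haD⟩, hb, hbD⟩
    rcases le_total a b with hab | hba
    · exact (hγ a haD b hbD hab).trans (lintegral_mono_set (Icc_subset_Icc ha.1.le hb.2.le))
    · rw [mem_ofPred_eq, edist_comm]
      exact (hγ b hbD a haD hba).trans (lintegral_mono_set (Icc_subset_Icc hb.1.le ha.2.le))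
  have hclosure : Icc s t ⊆ closure (Ioo s t ∩ D) := by
    rw [← closure_Ioo hlt.ne]
    exact closure_minimal (hD.open_subset_closure_inter isOpen_Ioo) isClosed_closure
  have hmem : (s, t) ∈ closure ((Ioo s t ∩ D) ×ˢ (Ioo s t ∩ D)) := by
    rw [closure_prod_eq]
    exact ⟨hclosure (left_mem_Icc.2 hst), hclosure (right_mem_Icc.2 hst)⟩
  exact closure_minimal hsub hclosed hmem

theorem measurable_lintegral_speed_sq :
    Measurable fun γ : C(I, X) => ∫⁻ τ, speed γ τ ^ 2 :=
  (measurable_speed_uncurry.pow_const 2).lintegral_prod_right'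

theorem measurableSet_isACCurve_inter :
    MeasurableSet {γ : C(I, X) | IsACCurve γ ∧ ∫⁻ τ, speed γ τ ^ 2 < ∞} := by
  obtain ⟨D, hDc, hD⟩ := TopologicalSpace.exists_countable_dense I
  have heq : {γ : C(I, X) | IsACCurve γ ∧ ∫⁻ τ, speed γ τ ^ 2 < ∞} =
      {γ | ∀ s ∈ D, ∀ t ∈ D, s ≤ t → edist (γ s) (γ t) ≤ ∫⁻ τ in Icc s t, speed γ τ} ∩
        {γ | ∫⁻ τ, speed γ τ ^ 2 < ∞} := by
    ext γ
    exact ⟨fun h => ⟨fun s _ t _ hst => h.1.edist_le_setLIntegral_speed hst, h.2⟩,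
      fun h => ⟨isACCurve_of_dense hD h.2 h.1, h.2⟩⟩
  rw [heq]
  refine MeasurableSet.inter ?_ (measurableSet_lt measurable_lintegral_speed_sq measurable_const)
  simp only [ofPred_forall]
  refine MeasurableSet.biInter hDc fun s _ => MeasurableSet.biInter hDc fun t _ =>
    MeasurableSet.iInter fun _ => measurableSet_le ?_ ?_
  · exact (by fun_prop : Continuous fun γ : C(I, X) => edist (γ s) (γ t)).measurable
  · exact measurable_speed_uncurry.lintegral_prod_right'

end MeasurableACCurve

namespace IsTestPlan

variable {X : Type*} [PseudoMetricSpace X] [MeasurableSpace X] {m : Measure X}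
  {π : Measure C(I, X)}

theorem ae_lintegral_speed_sq_lt_top (hπ : IsTestPlan m π) :
    ∀ᵐ γ ∂π, ∫⁻ t, speed γ t ^ 2 < ∞ :=
  ae_lt_top measurable_lintegral_speed_sq hπ.energy.ne

variable [BorelSpace X]

theorem ae_of_ae (hπ : IsTestPlan m π) (t : I) {P : X → Prop} (h : ∀ᵐ x ∂m, P x) :
    ∀ᵐ γ ∂π, P (γ t) := by
  obtain ⟨C, hC⟩ := hπ.compression
  exact ae_of_ae_map (measurable_eval t).aemeasurable
    ((Measure.absolutelyContinuous_of_le_smul (hC t)).ae_le h)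

theorem restrict (hπ : IsTestPlan m π) {s t : I} (hst : s < t) :
    IsTestPlan m (π.map fun γ => γ.comp (affineMap s t)) := by
  have hmeas : Measurable (fun γ : C(I, X) => γ.comp (affineMap s t)) :=
    (ContinuousMap.continuous_precomp _).measurable
  refine ⟨?_, ?_, ?_, ?_⟩
  · have := hπ.prob
    exact Measure.isProbabilityMeasure_map hmeas.aemeasurable
  · have hae : ∀ᵐ γ ∂π.map (fun γ => γ.comp (affineMap s t)),
        IsACCurve γ ∧ ∫⁻ τ, speed γ τ ^ 2 < ∞ := by
      rw [ae_map_iff hmeas.aemeasurable measurableSet_isACCurve_inter]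
      filter_upwards [hπ.ac, hπ.ae_lintegral_speed_sq_lt_top] with γ hγ hfin
      exact ⟨hγ.comp_affineMap hst, (lintegral_speed_sq_comp_affineMap_le γ hst).trans_lt hfin⟩
    exact hae.mono fun _ h => h.1
  · obtain ⟨C, hC⟩ := hπ.compression
    refine ⟨C, fun τ => ?_⟩
    rw [Measure.map_map (measurable_eval τ) hmeas]
    exact hC (affineMap s t τ)
  · refine (lintegral_map_le _ _).trans_lt ((lintegral_mono fun γ => ?_).trans_lt hπ.energy)
    exact lintegral_speed_sq_comp_affineMap_le γ hst

end IsTestPlan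

section LipschitzOnBounded

/-- Functions that are Lipschitz on bounded sets, the regularity of `h_t f` for `f ∈ L^p`. -/
def IsLipschitzOnBounded {X : Type*} [PseudoMetricSpace X] (u : X → ℝ) : Prop :=
  ∀ B : Set X, Bornology.IsBounded B → ∃ C : ℝ≥0, LipschitzOnWith C u B

namespace IsLipschitzOnBounded

variable {X : Type*} [PseudoMetricSpace X] {u : X → ℝ}

theorem continuous (hu : IsLipschitzOnBounded u) : Continuous u := by
  refine continuous_iff_continuousAt.2 fun x => ?_
  obtain ⟨C, hC⟩ := hu _ (Metric.isBounded_ball (x := x) (r := 1))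
  exact hC.continuousOn.continuousAt (Metric.ball_mem_nhds x one_pos)

theorem isWeakUpperGradient_lip [MeasurableSpace X] [BorelSpace X] {m : Measure X}
    (hu : IsLipschitzOnBounded u) : IsWeakUpperGradient m u (lip u) := by
  refine ⟨measurable_lip hu.continuous, fun π hπ => ?_⟩
  filter_upwards [hπ.ac, hπ.ae_lintegral_speed_sq_lt_top] with γ hγ hfin
  have hspeed : ∫⁻ τ, speed γ τ < ∞ := lintegral_lt_top_of_lintegral_sq_lt_top hfin
  have hrange : range γ ⊆ Metric.thickening 1 (range γ) := Metric.self_subset_thickening one_pos _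
  obtain ⟨C, hC⟩ := hu _ (isCompact_range γ.continuous).isBounded.thickening
  have hlip : ∀ τ, lip u (γ τ) ≤ C := fun τ => lip_le_of_lipschitzOnWith hC
    (Metric.isOpen_thickening.mem_nhds (hrange (mem_range_self τ)))
  constructor
  · calc edist (u (γ 1)) (u (γ 0)) ≤ ∫⁻ τ in Icc 0 1, lip (fun τ => u (γ τ)) τ := by
          rw [edist_comm]
          exact edist_le_setLIntegral_lip (v := fun τ => u (γ τ))
            (hγ.absolutelyContinuousOnInterval_comp (hC.mono hrange)) unitInterval.nonneg'
      _ ≤ ∫⁻ τ, lip (fun τ => u (γ τ)) τ := setLIntegral_le_lintegral _ _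
      _ ≤ lineIntegral (lip u) γ := by
          refine lintegral_mono_ae ?_
          filter_upwards [ae_lt_top (measurable_speed γ) hspeed.ne] with τ hτ
          exact lip_comp_le γ.continuous.continuousAt
            (ne_top_of_le_ne_top ENNReal.coe_ne_top (hlip τ)) hτ.ne
  · calc lineIntegral (lip u) γ ≤ ∫⁻ τ, C * speed γ τ :=
          lintegral_mono fun τ => mul_le_mul_left (hlip τ) _
      _ = C * ∫⁻ τ, speed γ τ := lintegral_const_mul _ (measurable_speed γ)
      _ < ∞ := ENNReal.mul_lt_top ENNReal.coe_lt_top hspeed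

end IsLipschitzOnBounded

end LipschitzOnBounded

section Partition

/-- The points `min (k / (N + 1)) 1` of the uniform partition of the unit interval into `N + 1`
cells. -/
noncomputable def gridPoint (N k : ℕ) : I :=
  Set.Icc.addNSMul (zero_le_one' ℝ) (1 / (N + 1)) k

theorem gridPoint_mono (N : ℕ) : Monotone (gridPoint N) :=
  Set.Icc.monotone_addNSMul _ Nat.one_div_pos_of_nat.le

theorem gridPoint_zero (N : ℕ) : gridPoint N 0 = 0 :=
  Subtype.ext (Set.Icc.addNSMul_zero _)

theorem exists_gridPoint_eq_one (N : ℕ) : ∃ n, gridPoint N n = 1 := by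
  obtain ⟨n, hn⟩ := Set.Icc.addNSMul_eq_right (zero_le_one' ℝ) (Nat.one_div_pos_of_nat (n := N))
  exact ⟨n, Subtype.ext (hn n le_rfl)⟩

theorem dist_gridPoint_le {N k : ℕ} {t : I}
    (ht : t ∈ Icc (gridPoint N k) (gridPoint N (k + 1))) : dist t (gridPoint N k) ≤ 1 / (N + 1) :=
  Set.Icc.abs_sub_addNSMul_le _ Nat.one_div_pos_of_nat.le k ht

theorem sum_measure_inter_Ioc_le {p : ℕ → I} (hp : Monotone p) (μ : Measure I) (A : Set I)
    (n : ℕ) : ∑ k ∈ Finset.range n, μ (Ioc (p k) (p (k + 1)) ∩ A) ≤ μ A := by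
  have hdisj : Pairwise (Function.onFun Disjoint fun k => Ioc (p k) (p (k + 1))) :=
    hp.pairwise_disjoint_on_Ioc_succ
  calc ∑ k ∈ Finset.range n, μ (Ioc (p k) (p (k + 1)) ∩ A)
      = ∑ k ∈ Finset.range n, μ.restrict A (Ioc (p k) (p (k + 1))) := by
        simp only [Measure.restrict_apply measurableSet_Ioc]
    _ ≤ μ.restrict A univ := sum_measure_le_measure_univ
        (fun _ _ => measurableSet_Ioc.nullMeasurableSet) fun _ _ _ _ h => (hdisj h).aedisjoint
    _ = μ A := Measure.restrict_apply_univ A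

variable {Y : Type*} [PseudoEMetricSpace Y] {v : I → Y}

theorem edist_le_add_of_isOpen_cover {μ₁ μ₂ : Measure I} {U₁ U₂ : Set I} (hU₁ : IsOpen U₁)
    (hU₂ : IsOpen U₂) (hU : ∀ t, t ∈ U₁ ∨ t ∈ U₂)
    (hv₁ : ∀ N k, edist (v (gridPoint N k)) (v (gridPoint N (k + 1)))
      ≤ μ₁ (Ioc (gridPoint N k) (gridPoint N (k + 1))))
    (hv₂ : ∀ N k, edist (v (gridPoint N k)) (v (gridPoint N (k + 1)))
      ≤ μ₂ (Ioc (gridPoint N k) (gridPoint N (k + 1)))) :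
    edist (v 0) (v 1) ≤ μ₁ U₁ + μ₂ U₂ := by
  obtain ⟨δ, hδ, hball⟩ := lebesgue_number_lemma_of_metric (c := fun b : Bool => cond b U₁ U₂)
    isCompact_univ (Bool.forall_bool.2 ⟨hU₂, hU₁⟩)
    fun t _ => (hU t).elim (fun h => mem_iUnion.2 ⟨true, h⟩) fun h => mem_iUnion.2 ⟨false, h⟩
  obtain ⟨N, hN⟩ := exists_nat_one_div_lt hδ
  obtain ⟨n, hn⟩ := exists_gridPoint_eq_one N
  have h0 : gridPoint N 0 = 0 := gridPoint_zero N
  set p := gridPoint N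
  have hp : Monotone p := gridPoint_mono N
  have hcell : ∀ k, edist (v (p k)) (v (p (k + 1))) ≤
      μ₁ (Ioc (p k) (p (k + 1)) ∩ U₁) + μ₂ (Ioc (p k) (p (k + 1)) ∩ U₂) := by
    intro k
    have hsub : Ioc (p k) (p (k + 1)) ⊆ Metric.ball (p k) δ := fun t ht =>
      (dist_gridPoint_le (Ioc_subset_Icc_self ht)).trans_lt hN
    obtain ⟨_ | _, hb⟩ := hball (p k) (mem_univ _)
    · rw [inter_eq_self_of_subset_left (t := U₂) (hsub.trans hb)]
      exact (hv₂ N k).trans le_add_self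
    · rw [inter_eq_self_of_subset_left (t := U₁) (hsub.trans hb)]
      exact (hv₁ N k).trans le_self_add
  calc edist (v 0) (v 1) = edist (v (p 0)) (v (p n)) := by rw [h0, hn]
    _ ≤ ∑ k ∈ Finset.range n, edist (v (p k)) (v (p (k + 1))) :=
        edist_le_range_sum_edist (fun k => v (p k)) n
    _ ≤ ∑ k ∈ Finset.range n,
          (μ₁ (Ioc (p k) (p (k + 1)) ∩ U₁) + μ₂ (Ioc (p k) (p (k + 1)) ∩ U₂)) :=
        Finset.sum_le_sum fun k _ => hcell k
    _ ≤ μ₁ U₁ + μ₂ U₂ := by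
        rw [Finset.sum_add_distrib]
        exact add_le_add (sum_measure_inter_Ioc_le hp μ₁ U₁ n) (sum_measure_inter_Ioc_le hp μ₂ U₂ n)

theorem edist_le_lintegral_min {h₁ h₂ : I → ℝ≥0∞} (hm₁ : Measurable h₁) (hm₂ : Measurable h₂)
    (hf₁ : ∫⁻ t, h₁ t ≠ ∞) (hf₂ : ∫⁻ t, h₂ t ≠ ∞)
    (hv₁ : ∀ N k, edist (v (gridPoint N k)) (v (gridPoint N (k + 1)))
      ≤ ∫⁻ t in Icc (gridPoint N k) (gridPoint N (k + 1)), h₁ t)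
    (hv₂ : ∀ N k, edist (v (gridPoint N k)) (v (gridPoint N (k + 1)))
      ≤ ∫⁻ t in Icc (gridPoint N k) (gridPoint N (k + 1)), h₂ t) :
    edist (v 0) (v 1) ≤ ∫⁻ t, min (h₁ t) (h₂ t) := by
  set μ₁ := (volume : Measure I).withDensity h₁
  set μ₂ := (volume : Measure I).withDensity h₂
  have : IsFiniteMeasure μ₁ := isFiniteMeasure_withDensity hf₁
  have : IsFiniteMeasure μ₂ := isFiniteMeasure_withDensity hf₂
  simp only [restrict_Ioc_eq_restrict_Icc.symm, ← withDensity_apply _ measurableSet_Ioc]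
    at hv₁ hv₂
  set A := {t | h₁ t ≤ h₂ t}
  have hA : MeasurableSet A := measurableSet_le hm₁ hm₂
  have hmin : ∫⁻ t, min (h₁ t) (h₂ t) = μ₁ A + μ₂ Aᶜ := by
    rw [← lintegral_add_compl _ hA, withDensity_apply _ hA, withDensity_apply _ hA.compl]
    congr 1
    · exact setLIntegral_congr_fun hA fun t ht => min_eq_left ht
    · exact setLIntegral_congr_fun hA.compl fun t ht => min_eq_right (le_of_not_ge ht)
  rw [hmin]
  refine ENNReal.le_of_forall_pos_le_add fun ε hε _ => ?_
  have hε' : (ε / 2 : ℝ≥0∞) ≠ 0 := by simp [hε.ne']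
  obtain ⟨U₁, hAU₁, hU₁, hμU₁⟩ := A.exists_isOpen_lt_add (measure_ne_top μ₁ A) hε'
  obtain ⟨U₂, hAU₂, hU₂, hμU₂⟩ := Aᶜ.exists_isOpen_lt_add (measure_ne_top μ₂ Aᶜ) hε'
  calc edist (v 0) (v 1) ≤ μ₁ U₁ + μ₂ U₂ := edist_le_add_of_isOpen_cover hU₁ hU₂
        (fun t => (em (t ∈ A)).imp (@hAU₁ t) (@hAU₂ t)) hv₁ hv₂
    _ ≤ μ₁ A + ε / 2 + (μ₂ Aᶜ + ε / 2) := add_le_add hμU₁.le hμU₂.le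
    _ = μ₁ A + μ₂ Aᶜ + ε := by rw [add_add_add_comm, ENNReal.add_halves]

end Partition

namespace IsWeakUpperGradient

variable {X : Type*} [PseudoMetricSpace X] [MeasurableSpace X] {m : Measure X} {f : X → ℝ}
  {G : X → ℝ≥0∞}

theorem comp_lipschitz (hG : IsWeakUpperGradient m f G) {φ : ℝ → ℝ} (hφ : LipschitzWith 1 φ) :
    IsWeakUpperGradient m (fun x => φ (f x)) G := by
  refine ⟨hG.1, fun π hπ => ?_⟩
  filter_upwards [hG.2 π hπ] with γ hγ
  refine ⟨le_trans ?_ hγ.1, hγ.2⟩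
  simpa using hφ.edist_le_mul (f (γ 1)) (f (γ 0))

variable [BorelSpace X]

theorem congr {f' : X → ℝ} (hG : IsWeakUpperGradient m f G) (hff' : f =ᵐ[m] f') :
    IsWeakUpperGradient m f' G := by
  refine ⟨hG.1, fun π hπ => ?_⟩
  filter_upwards [hG.2 π hπ, hπ.ae_of_ae 0 hff', hπ.ae_of_ae 1 hff'] with γ hγ h0 h1
  rwa [← h0, ← h1]

theorem measurable_lineIntegrand (hG : Measurable G) (γ : C(I, X)) :
    Measurable fun t => G (γ t) * speed γ t :=
  (hG.comp γ.continuous.measurable).mul (measurable_speed γ)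

theorem ae_edist_gridPoint_le (hG : IsWeakUpperGradient m f G) {π : Measure C(I, X)}
    (hπ : IsTestPlan m π) :
    ∀ᵐ γ ∂π, ∀ N k, edist (f (γ (gridPoint N k))) (f (γ (gridPoint N (k + 1))))
      ≤ ∫⁻ t in Icc (gridPoint N k) (gridPoint N (k + 1)), G (γ t) * speed γ t := by
  refine ae_all_iff.2 fun N => ae_all_iff.2 fun k => ?_
  rcases (gridPoint_mono N k.le_succ).eq_or_lt with heq | hlt
  · refine Eventually.of_forall fun γ => ?_
    rw [← Nat.succ_eq_add_one, ← heq, edist_self]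
    exact zero_le
  · have hmeas : Measurable (fun γ : C(I, X) =>
        γ.comp (affineMap (gridPoint N k) (gridPoint N (k + 1)))) :=
      (ContinuousMap.continuous_precomp _).measurable
    filter_upwards [ae_of_ae_map hmeas.aemeasurable (hG.2 _ (hπ.restrict hlt))] with γ hγ
    simpa only [ContinuousMap.comp_apply, affineMap_zero, affineMap_one, edist_comm]
      using hγ.1.trans (lineIntegral_comp_affineMap_le G γ hlt)

theorem min {G₁ G₂ : X → ℝ≥0∞} (h₁ : IsWeakUpperGradient m f G₁)
    (h₂ : IsWeakUpperGradient m f G₂) : IsWeakUpperGradient m f (fun x => min (G₁ x) (G₂ x)) := by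
  refine ⟨h₁.1.min h₂.1, fun π hπ => ?_⟩
  filter_upwards [h₁.2 π hπ, h₂.2 π hπ, h₁.ae_edist_gridPoint_le hπ, h₂.ae_edist_gridPoint_le hπ]
    with γ hγ₁ hγ₂ hgrid₁ hgrid₂
  constructor
  · rw [edist_comm]
    refine (edist_le_lintegral_min (v := fun t => f (γ t)) (measurable_lineIntegrand h₁.1 γ)
      (measurable_lineIntegrand h₂.1 γ) hγ₁.2.ne hγ₂.2.ne hgrid₁ hgrid₂).trans_eq ?_
    exact lintegral_congr fun t => min_mul_mul_right _ _ _
  · exact (lintegral_mono fun t => mul_le_mul_left (min_le_left _ _) _).trans_lt hγ₁.2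

theorem iInf_of_antitone {G : ℕ → X → ℝ≥0∞} (hG : ∀ n, IsWeakUpperGradient m f (G n))
    (hanti : Antitone G) : IsWeakUpperGradient m f (fun x => ⨅ n, G n x) := by
  refine ⟨Measurable.iInf fun n => (hG n).1, fun π hπ => ?_⟩
  filter_upwards [ae_all_iff.2 fun n => (hG n).2 π hπ, hπ.ae_lintegral_speed_sq_lt_top]
    with γ hγ hfin
  have hspeed : ∫⁻ t, speed γ t ≠ ∞ := (lintegral_lt_top_of_lintegral_sq_lt_top hfin).ne
  have heq : lineIntegral (fun x => ⨅ n, G n x) γ = ⨅ n, lineIntegral (G n) γ := by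
    simp only [lineIntegral]
    rw [← lintegral_iInf (fun n => measurable_lineIntegrand (hG n).1 γ)
      (fun a b hab t => mul_le_mul_left (hanti hab _) _) (hγ 0).2.ne]
    refine lintegral_congr_ae ?_
    filter_upwards [ae_lt_top (measurable_speed γ) hspeed] with t ht
    exact ENNReal.iInf_mul fun htop => absurd htop ht.ne
  rw [heq]
  exact ⟨le_iInf fun n => (hγ n).1, (iInf_le _ 0).trans_lt (hγ 0).2⟩

end IsWeakUpperGradient

section LeastElement

variable {X : Type*} [MeasurableSpace X] {m : Measure X} {S : Set (X → ℝ≥0∞)}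

theorem exists_forall_lintegral_inv_le {μ : Measure X} (hne : S.Nonempty)
    (hmin : ∀ G₁ ∈ S, ∀ G₂ ∈ S, (fun x => min (G₁ x) (G₂ x)) ∈ S)
    (hinf : ∀ G : ℕ → X → ℝ≥0∞, Antitone G → (∀ n, G n ∈ S) → (fun x => ⨅ n, G n x) ∈ S) :
    ∃ G ∈ S, ∀ G' ∈ S, ∫⁻ x, (1 + G' x)⁻¹ ∂μ ≤ ∫⁻ x, (1 + G x)⁻¹ ∂μ := by
  set J : (X → ℝ≥0∞) → ℝ≥0∞ := fun G => ∫⁻ x, (1 + G x)⁻¹ ∂μ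
  have hJ : ∀ G G' : X → ℝ≥0∞, G ≤ G' → J G' ≤ J G := fun G G' h =>
    lintegral_mono fun x => ENNReal.inv_le_inv.2 (add_le_add_right (h x) 1)
  obtain ⟨a, -, ha, haS⟩ := exists_seq_tendsto_sSup (hne.image J) (OrderTop.bddAbove _)
  choose g hgS hga using haS
  let G : ℕ → X → ℝ≥0∞ := fun n =>
    Nat.rec (g 0) (fun k Gk x => min (Gk x) (g (k + 1) x)) n
  have hGS : ∀ n, G n ∈ S := fun n => by
    induction n with
    | zero => exact hgS 0
    | succ k ih => exact hmin _ ih _ (hgS (k + 1))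
  have hanti : Antitone G := antitone_nat_of_succ_le fun k x => min_le_left _ _
  have hGg : ∀ n, G n ≤ g n := fun n x => by
    cases n with
    | zero => exact le_rfl
    | succ k => exact min_le_right _ _
  refine ⟨_, hinf G hanti hGS, fun G' hG' => ?_⟩
  refine (le_sSup (mem_image_of_mem J hG')).trans (le_of_tendsto' ha fun n => ?_)
  rw [← hga]
  exact hJ _ _ fun x => (iInf_le _ n).trans (hGg n x)

theorem exists_ae_least [SFinite m] (hne : S.Nonempty) (hmeas : ∀ G ∈ S, Measurable G)
    (hmin : ∀ G₁ ∈ S, ∀ G₂ ∈ S, (fun x => min (G₁ x) (G₂ x)) ∈ S)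
    (hinf : ∀ G : ℕ → X → ℝ≥0∞, Antitone G → (∀ n, G n ∈ S) → (fun x => ⨅ n, G n x) ∈ S) :
    ∃ G ∈ S, ∀ G' ∈ S, G ≤ᵐ[m] G' := by
  obtain ⟨G, hG, hmax⟩ := exists_forall_lintegral_inv_le (μ := m.toFinite) hne hmin hinf
  refine ⟨G, hG, fun G' hG' => ?_⟩
  have hGG' := hmin G hG G' hG'
  have hfin : ∫⁻ x, (1 + G x)⁻¹ ∂m.toFinite ≠ ∞ := by
    refine ne_top_of_le_ne_top (measure_ne_top m.toFinite univ) ?_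
    refine (lintegral_mono fun x => ?_).trans_eq lintegral_one
    exact ENNReal.inv_le_one.2 le_self_add
  have hae : (fun x => (1 + G x)⁻¹) =ᵐ[m.toFinite] fun x => (1 + min (G x) (G' x))⁻¹ :=
    ae_eq_of_ae_le_of_lintegral_le
      (Eventually.of_forall fun x =>
        ENNReal.inv_le_inv.2 (add_le_add_right (min_le_left _ _) 1))
      hfin ((hmeas _ hGG').const_add 1).inv.aemeasurable (hmax _ hGG')
  filter_upwards [(absolutelyContinuous_toFinite m).ae_le hae] with x hx
  have heq : G x = min (G x) (G' x) :=
    (ENNReal.add_right_inj ENNReal.one_ne_top).1 (inv_injective hx)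
  exact heq.le.trans (min_le_right _ _)

end LeastElement

theorem IsWeakUpperGradient.isMinimalWeakUpperGradient_minWeakUpperGradient {X : Type*}
    [PseudoMetricSpace X] [MeasurableSpace X] [BorelSpace X]
    {m : Measure X} [SFinite m] {f : X → ℝ} {G : X → ℝ≥0∞} (hG : IsWeakUpperGradient m f G) :
    IsMinimalWeakUpperGradient m f (minWeakUpperGradient m f) := by
  have hex : ∃ G', IsMinimalWeakUpperGradient m f G' :=
    exists_ae_least (S := {G' | IsWeakUpperGradient m f G'}) ⟨G, hG⟩ (fun _ h => h.1)
      (fun _ h₁ _ h₂ => h₁.min h₂) fun _ hanti h => iInf_of_antitone h hanti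
  rw [minWeakUpperGradient, dif_pos hex]
  exact hex.choose_spec

section Clamp

/-- Truncation of a real number to `[-1, 1]`. -/
noncomputable def clamp (x : ℝ) : ℝ := max (-1) (min x 1)

theorem lipschitzWith_clamp : LipschitzWith 1 clamp :=
  (LipschitzWith.id.min_const 1).const_max (-1)

theorem clamp_zero : clamp 0 = 0 := by simp [clamp]

theorem lipschitzWith_sub_clamp : LipschitzWith 1 (fun x => x - clamp x) := by
  refine LipschitzWith.of_dist_le_mul fun x y => ?_
  simp only [clamp, Real.dist_eq, NNReal.coe_one, one_mul]
  grind

theorem clamp_mem_Icc (x : ℝ) : clamp x ∈ Icc (-1) 1 :=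
  ⟨le_max_left _ _, max_le (by norm_num) (min_le_right _ _)⟩

theorem sub_clamp_mul_clamp_sub_nonpos (x y : ℝ) : (x - clamp x) * (clamp y - clamp x) ≤ 0 := by
  obtain ⟨hlow, hup⟩ := clamp_mem_Icc y
  rcases le_total 1 x with hx | hx
  · have hclamp : clamp x = 1 := by simp [clamp, hx]
    rw [hclamp]
    exact mul_nonpos_of_nonneg_of_nonpos (by linarith) (by linarith)
  rcases le_total x (-1) with hx' | hx'
  · have hclamp : clamp x = -1 := by simp [clamp, hx, hx']
    rw [hclamp]
    exact mul_nonpos_of_nonpos_of_nonneg (by linarith) (by linarith)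
  · have hclamp : clamp x = x := by simp [clamp, hx, hx']
    simp [hclamp]

/-- The Huber function: `x² / 2` on `[-1, 1]` and `|x| - 1 / 2` elsewhere. -/
noncomputable def huber (x : ℝ) : ℝ := x * clamp x - 2⁻¹ * clamp x ^ 2

theorem huber_nonneg (x : ℝ) : 0 ≤ huber x := by
  simp only [huber, clamp]
  rcases le_total x 1 with h1 | h1 <;> rcases le_total x (-1) with h2 | h2 <;>
    simp [h1, h2] <;> nlinarith

theorem huber_le_abs (x : ℝ) : huber x ≤ |x| := by
  simp only [huber, clamp]
  rcases le_total x 1 with h1 | h1 <;> rcases le_total x (-1) with h2 | h2 <;>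
    rcases abs_cases x with ⟨h3, h4⟩ | ⟨h3, h4⟩ <;> simp [h1, h2, h3] <;> nlinarith

theorem abs_le_huber_add_one (x : ℝ) : |x| ≤ huber x + 1 := by
  simp only [huber, clamp]
  rcases le_total x 1 with h1 | h1 <;> rcases le_total x (-1) with h2 | h2 <;>
    rcases abs_cases x with ⟨h3, h4⟩ | ⟨h3, h4⟩ <;> simp [h1, h2, h3] <;> nlinarith

end Clamp

section ClampLp

variable {X : Type*} [MeasurableSpace X] {m : Measure X}

/-- Truncation to `[-1, 1]` on `L²`. -/
noncomputable def clampLp (m : Measure X) (u : Lp ℝ 2 m) : Lp ℝ 2 m :=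
  lipschitzWith_clamp.compLp clamp_zero u

theorem coeFn_clampLp (u : Lp ℝ 2 m) : clampLp m u =ᵐ[m] fun x => clamp (u x) :=
  lipschitzWith_clamp.coeFn_compLp clamp_zero u

theorem coeFn_sub_clampLp (u : Lp ℝ 2 m) :
    (u - clampLp m u : Lp ℝ 2 m) =ᵐ[m] fun x => u x - clamp (u x) := by
  filter_upwards [Lp.coeFn_sub u (clampLp m u), coeFn_clampLp u] with x hsub hclamp
  rw [hsub, Pi.sub_apply, hclamp]

theorem isMetricProjection_clampLp : IsMetricProjection (clampLp m) := by
  intro u v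
  rw [L2.inner_def]
  refine integral_nonpos_of_ae ?_
  filter_upwards [coeFn_sub_clampLp u, coeFn_clampLp u, coeFn_clampLp v,
    Lp.coeFn_sub (clampLp m v) (clampLp m u)] with x husub hu hv hsub
  rw [husub, hsub, Pi.sub_apply, hu, hv]
  simpa [mul_comm] using sub_clamp_mul_clamp_sub_nonpos (u x) (v x)

theorem norm_clampLp_le (u : Lp ℝ 2 m) : ‖clampLp m u‖ ≤ ‖u‖ := by
  simpa [clampLp] using lipschitzWith_clamp.norm_compLp_le clamp_zero u

theorem ofReal_envelope_clampLp (u : Lp ℝ 2 m) :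
    ENNReal.ofReal (envelope (clampLp m) u) = ∫⁻ x, ENNReal.ofReal (huber (u x)) ∂m := by
  have hae : (fun x => inner ℝ (u x) (clampLp m u x) -
      2⁻¹ * inner ℝ (clampLp m u x) (clampLp m u x)) =ᵐ[m] fun x => huber (u x) := by
    filter_upwards [coeFn_clampLp u] with x hx
    simp only [hx, huber, RCLike.inner_apply, conj_trivial]
    ring
  have hint := L2.integrable_inner (𝕜 := ℝ) u (clampLp m u)
  have hint' := (L2.integrable_inner (𝕜 := ℝ) (clampLp m u) (clampLp m u)).const_mul 2⁻¹
  have heq : envelope (clampLp m) u = ∫ x, huber (u x) ∂m := by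
    rw [envelope, ← real_inner_self_eq_norm_sq, L2.inner_def, L2.inner_def, ← integral_const_mul,
      ← integral_sub hint hint']
    exact integral_congr_ae hae
  rw [heq, ofReal_integral_eq_lintegral_ofReal ((hint.sub hint').congr hae)
    (Eventually.of_forall fun x => huber_nonneg _)]

theorem ofReal_envelope_clampLp_le (u : Lp ℝ 2 m) :
    ENNReal.ofReal (envelope (clampLp m) u) ≤ ∫⁻ x, ‖u x‖ₑ ∂m := by
  rw [ofReal_envelope_clampLp]
  refine lintegral_mono fun x => ?_
  rw [Real.enorm_eq_ofReal_abs]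
  exact ENNReal.ofReal_le_ofReal (huber_le_abs _)

theorem setLIntegral_enorm_le_ofReal_envelope_add (u : Lp ℝ 2 m) (B : Set X) :
    ∫⁻ x in B, ‖u x‖ₑ ∂m ≤ ENNReal.ofReal (envelope (clampLp m) u) + m B := by
  calc ∫⁻ x in B, ‖u x‖ₑ ∂m ≤ ∫⁻ x in B, (ENNReal.ofReal (huber (u x)) + 1) ∂m := by
        refine lintegral_mono fun x => ?_
        rw [Real.enorm_eq_ofReal_abs, ← ENNReal.ofReal_one,
          ← ENNReal.ofReal_add (huber_nonneg _) zero_le_one]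
        exact ENNReal.ofReal_le_ofReal (abs_le_huber_add_one _)
    _ = ∫⁻ x in B, ENNReal.ofReal (huber (u x)) ∂m + m B := by
        rw [lintegral_add_right _ measurable_const, lintegral_one, Measure.restrict_apply_univ]
    _ ≤ ENNReal.ofReal (envelope (clampLp m) u) + m B := by
        rw [ofReal_envelope_clampLp]
        exact add_le_add_left (setLIntegral_le_lintegral _ _) _

end ClampLp

section HeatFlow

variable {X : Type*} [PseudoMetricSpace X] [MeasurableSpace X] [BorelSpace X] {m : Measure X}
  [SFinite m]

theorem cheegerEnergy_sub_clampLp_le (u : Lp ℝ 2 m) :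
    cheegerEnergy m (u - clampLp m u) ≤ cheegerEnergy m u := by
  by_cases hex : ∃ G, IsMinimalWeakUpperGradient m u G
  · obtain ⟨G, hG, -⟩ := hex
    have hwug : IsWeakUpperGradient m (u - clampLp m u : Lp ℝ 2 m) (minWeakUpperGradient m u) :=
      (hG.isMinimalWeakUpperGradient_minWeakUpperGradient.1.comp_lipschitz
        lipschitzWith_sub_clamp).congr (coeFn_sub_clampLp u).symm
    refine mul_le_mul_right (lintegral_mono_ae ?_) _
    filter_upwards [hwug.isMinimalWeakUpperGradient_minWeakUpperGradient.2 _ hwug] with x hx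
    exact pow_le_pow_left' hx 2
  · rcases eq_or_ne m 0 with hm | hm
    · simp [cheegerEnergy, hm]
    · have htop : cheegerEnergy m u = ∞ := by
        rw [cheegerEnergy, minWeakUpperGradient, dif_neg hex]
        simp [ENNReal.top_mul, hm]
      exact htop ▸ le_top

theorem setLIntegral_heatFlow_le {t : ℝ} (ht : 0 < t) (f : Lp ℝ 2 m) (B : Set X) :
    ∫⁻ x in B, ‖heatFlow m t f x‖ₑ ∂m ≤ ∫⁻ x, ‖f x‖ₑ ∂m + m B := by
  by_cases hex : ∃ u, IsGradientFlow (cheegerEnergy m) f u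
  · rw [heatFlow, dif_pos hex]
    refine (setLIntegral_enorm_le_ofReal_envelope_add _ B).trans (add_le_add_left ?_ _)
    exact (ENNReal.ofReal_le_ofReal (hex.choose_spec.envelope_le isMetricProjection_clampLp
      norm_clampLp_le cheegerEnergy_sub_clampLp_le ht)).trans (ofReal_envelope_clampLp_le f)
  · have hzero : ∀ᵐ x ∂m.restrict B, ‖(0 : Lp ℝ 2 m) x‖ₑ = 0 :=
      ae_restrict_of_ae ((Lp.coeFn_zero ℝ 2 m).mono fun x hx => by rw [hx]; exact enorm_zero)
    rw [heatFlow, dif_neg hex, lintegral_congr_ae hzero, lintegral_zero]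
    exact zero_le

end HeatFlow

section Truncation

variable {X : Type*} [MeasurableSpace X] {m : Measure X} [SigmaFinite m] {F : X → ℝ≥0}

/-- The bounded functions `min F n`, cut off outside of a set of finite measure that exhausts the
space as `n → ∞`. -/
noncomputable def truncation (m : Measure X) [SigmaFinite m] (F : X → ℝ≥0) (n : ℕ) : X → ℝ≥0 :=
  (spanningSets m n).indicator fun z => min (F z) n

theorem measurable_truncation (hF : Measurable F) (n : ℕ) : Measurable (truncation m F n) :=
  (hF.min measurable_const).indicator (measurableSet_spanningSets m n)

theorem truncation_le (n : ℕ) (z : X) : truncation m F n z ≤ F z :=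
  (indicator_le_self' (fun _ _ => zero_le) z).trans (min_le_left _ _)

theorem truncation_le_natCast (n : ℕ) (z : X) : truncation m F n z ≤ n :=
  (indicator_le_self' (fun _ _ => zero_le) z).trans (min_le_right _ _)

theorem monotone_truncation : Monotone (truncation m F) := fun _ _ hab z =>
  (indicator_le_indicator_of_subset (monotone_spanningSets m hab) (fun _ => zero_le) z).trans
    (indicator_le_indicator (min_le_min_left _ (Nat.cast_le.2 hab)))

theorem memLp_truncation (hF : Measurable F) (n : ℕ) (p : ℝ≥0∞) :
    MemLp (fun z => (truncation m F n z : ℝ)) p m := by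
  refine (memLp_indicator_const p (measurableSet_spanningSets m n) (n : ℝ)
    (Or.inr (measure_spanningSets_lt_top m n).ne)).mono
    (measurable_truncation hF n).coe_nnreal_real.aestronglyMeasurable
    (Eventually.of_forall fun z => ?_)
  by_cases hz : z ∈ spanningSets m n
  · simpa [hz] using NNReal.coe_le_coe.2 (truncation_le_natCast (m := m) (F := F) n z)
  · simp [truncation, hz]

theorem exists_truncation_eq (m : Measure X) [SigmaFinite m] (F : X → ℝ≥0) (z : X) :
    ∃ n, truncation m F n z = F z := by
  obtain ⟨n, hn⟩ := exists_nat_ge (F z)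
  refine ⟨max n (spanningSetsIndex m z), ?_⟩
  have hmem : z ∈ spanningSets m (max n (spanningSetsIndex m z)) :=
    monotone_spanningSets m (le_max_right _ _) (mem_spanningSetsIndex m z)
  rw [truncation, indicator_of_mem hmem,
    min_eq_left (hn.trans (Nat.cast_le.2 (le_max_left _ _)))]

theorem lintegral_eq_iSup_truncation (m : Measure X) [SigmaFinite m] (hF : Measurable F)
    (ν : Measure X) : ∫⁻ z, F z ∂ν = ⨆ n, ∫⁻ z, truncation m F n z ∂ν := by
  rw [← lintegral_iSup (fun n => (measurable_truncation hF n).coe_nnreal_ennreal)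
    fun a b hab z => ENNReal.coe_le_coe.2 (monotone_truncation hab z)]
  refine lintegral_congr fun z =>
    le_antisymm ?_ (iSup_le fun n => ENNReal.coe_le_coe.2 (truncation_le n z))
  obtain ⟨n, hn⟩ := exists_truncation_eq m F z
  exact le_iSup_of_le n (by rw [hn])

end Truncation

section Kernel

variable {X : Type*} [MeasurableSpace X] {m : Measure X} {r : ℝ → X → X → ℝ} {t : ℝ}

/-- The probability measure `r_t[x] m`. -/
noncomputable def kernelMeasure (m : Measure X) (r : ℝ → X → X → ℝ) (t : ℝ) (x : X) : Measure X :=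
  m.withDensity fun y => ENNReal.ofReal (r t x y)

theorem kernelMeasure_absolutelyContinuous (t : ℝ) (x : X) : kernelMeasure m r t x ≪ m :=
  withDensity_absolutelyContinuous _ _

theorem kernelFlow_congr {f g : X → ℝ} (h : f =ᵐ[m] g) :
    kernelFlow m r t f = kernelFlow m r t g :=
  funext fun x => integral_congr_ae (h.mono fun y hy => congrArg (· * r t x y) hy)

namespace IsHeatKernel

variable [PseudoMetricSpace X]

theorem aemeasurable_density (hr : IsHeatKernel m r) (ht : 0 < t) (x : X) :
    AEMeasurable (fun y => ENNReal.ofReal (r t x y)) m :=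
  (hr.integrable t ht x).aestronglyMeasurable.aemeasurable.ennreal_ofReal

theorem ofReal_ne_zero (hr : IsHeatKernel m r) (ht : 0 < t) (x y : X) :
    ENNReal.ofReal (r t x y) ≠ 0 :=
  (ENNReal.ofReal_pos.2 (hr.pos t ht x y)).ne'

theorem isProbabilityMeasure (hr : IsHeatKernel m r) (ht : 0 < t) (x : X) :
    IsProbabilityMeasure (kernelMeasure m r t x) := by
  refine ⟨?_⟩
  rw [kernelMeasure, withDensity_apply _ MeasurableSet.univ, Measure.restrict_univ,
    ← ofReal_integral_eq_lintegral_ofReal (hr.integrable t ht x)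
      (Eventually.of_forall fun y => (hr.pos t ht x y).le), hr.integral_eq_one t ht x,
    ENNReal.ofReal_one]

theorem absolutelyContinuous (hr : IsHeatKernel m r) (ht : 0 < t) (x : X) :
    m ≪ kernelMeasure m r t x :=
  withDensity_absolutelyContinuous' (hr.aemeasurable_density ht x)
    (Eventually.of_forall (hr.ofReal_ne_zero ht x))

theorem sigmaFinite (hr : IsHeatKernel m r) : SigmaFinite m := by
  rcases isEmpty_or_nonempty X with hX | ⟨⟨x⟩⟩
  · rw [m.eq_zero_of_isEmpty]
    infer_instance
  · have := hr.isProbabilityMeasure one_pos x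
    rw [← withDensity_inv_same₀ (hr.aemeasurable_density one_pos x)
      (Eventually.of_forall (hr.ofReal_ne_zero one_pos x))
      (Eventually.of_forall fun y => ENNReal.ofReal_ne_top)]
    exact SigmaFinite.withDensity_of_ne_top' (μ := kernelMeasure m r 1 x)
      fun y => ENNReal.inv_ne_top.2 (hr.ofReal_ne_zero one_pos x y)

theorem integral_kernelMeasure (hr : IsHeatKernel m r) (ht : 0 < t) (f : X → ℝ) (x : X) :
    ∫ y, f y ∂kernelMeasure m r t x = kernelFlow m r t f x := by
  rw [kernelMeasure, integral_withDensity_eq_integral_toReal_smul₀ (hr.aemeasurable_density ht x)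
    (Eventually.of_forall fun y => ENNReal.ofReal_lt_top), kernelFlow]
  simp only [ENNReal.toReal_ofReal (hr.pos t ht x _).le, smul_eq_mul, mul_comm]

theorem integrable_kernelMeasure_iff (hr : IsHeatKernel m r) (ht : 0 < t) (f : X → ℝ) (x : X) :
    Integrable f (kernelMeasure m r t x) ↔ Integrable (fun y => f y * r t x y) m := by
  rw [kernelMeasure, integrable_withDensity_iff_integrable_smul₀' (hr.aemeasurable_density ht x)
    (Eventually.of_forall fun y => ENNReal.ofReal_lt_top)]
  simp only [ENNReal.toReal_ofReal (hr.pos t ht x _).le, smul_eq_mul, mul_comm]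

theorem lintegral_kernelMeasure_eq_ofReal (hr : IsHeatKernel m r) (ht : 0 < t) {F : X → ℝ≥0}
    (hF : Measurable F) {C : ℝ≥0} (hC : ∀ z, F z ≤ C) (x : X) :
    ∫⁻ y, F y ∂kernelMeasure m r t x = ENNReal.ofReal (kernelFlow m r t (fun y => F y) x) := by
  have := hr.isProbabilityMeasure ht x
  have hint : Integrable (fun y => (F y : ℝ)) (kernelMeasure m r t x) :=
    Integrable.of_bound hF.coe_nnreal_real.aestronglyMeasurable C
      (Eventually.of_forall fun z => by simpa using NNReal.coe_le_coe.2 (hC z))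
  rw [← hr.integral_kernelMeasure ht, ofReal_integral_eq_lintegral_ofReal hint
    (Eventually.of_forall fun y => NNReal.coe_nonneg _)]
  simp only [ENNReal.ofReal_coe_nnreal]

theorem kernelFlow_coe_nonneg (hr : IsHeatKernel m r) (ht : 0 < t) (F : X → ℝ≥0) (x : X) :
    0 ≤ kernelFlow m r t (fun y => F y) x := by
  rw [← hr.integral_kernelMeasure ht]
  exact integral_nonneg fun y => NNReal.coe_nonneg _

variable [SigmaFinite m] {F : X → ℝ≥0}

theorem enorm_heatFlow_truncation_ae_eq (hr : IsHeatKernel m r) (ht : 0 < t) (hF : Measurable F)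
    (n : ℕ) : (fun x => ‖heatFlow m t ((memLp_truncation hF n 2).toLp _) x‖ₑ) =ᵐ[m]
      fun x => ∫⁻ y, truncation m F n y ∂kernelMeasure m r t x := by
  filter_upwards [hr.represents t ht ((memLp_truncation hF n 2).toLp _)] with x hx
  rw [hx, kernelFlow_congr (memLp_truncation hF n 2).coeFn_toLp,
    hr.lintegral_kernelMeasure_eq_ofReal ht (measurable_truncation hF n)
      (truncation_le_natCast n), Real.enorm_of_nonneg (hr.kernelFlow_coe_nonneg ht _ x)]

variable [BorelSpace X]

theorem setLIntegral_lintegral_truncation_le (hr : IsHeatKernel m r) (ht : 0 < t)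
    (hF : Measurable F) (B : Set X) (n : ℕ) :
    ∫⁻ x in B, ∫⁻ y, truncation m F n y ∂kernelMeasure m r t x ∂m ≤ ∫⁻ x, F x ∂m + m B := by
  rw [← lintegral_congr_ae
    (ae_restrict_of_ae (hr.enorm_heatFlow_truncation_ae_eq ht hF n))]
  refine (setLIntegral_heatFlow_le ht _ B).trans (add_le_add_left ?_ _)
  refine lintegral_mono_ae ((memLp_truncation hF n 2).coeFn_toLp.mono fun x hx => ?_)
  rw [hx, NNReal.enorm_eq]
  exact ENNReal.coe_le_coe.2 (truncation_le n x)

theorem setLIntegral_lintegral_le (hr : IsHeatKernel m r) (ht : 0 < t) (hF : Measurable F)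
    (B : Set X) : ∫⁻ x in B, ∫⁻ y, F y ∂kernelMeasure m r t x ∂m ≤ ∫⁻ x, F x ∂m + m B := by
  simp only [lintegral_eq_iSup_truncation m hF]
  rw [lintegral_iSup']
  · exact iSup_le fun n => by
      rw [← lintegral_eq_iSup_truncation m hF]
      exact hr.setLIntegral_lintegral_truncation_le ht hF B n
  · exact fun n => ((Lp.stronglyMeasurable _).measurable.enorm.aemeasurable.congr
      (hr.enorm_heatFlow_truncation_ae_eq ht hF n)).restrict
  · exact Eventually.of_forall fun x a b hab =>
      lintegral_mono fun y => ENNReal.coe_le_coe.2 (monotone_truncation hab y)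

theorem exists_lintegral_ne_top [Nonempty X] (hr : IsHeatKernel m r) (ht : 0 < t)
    (hF : Measurable F) (hfin : ∫⁻ x, F x ∂m ≠ ∞) :
    ∃ y, ∫⁻ z, F z ∂kernelMeasure m r t y ≠ ∞ := by
  by_contra! htop
  have hspan : ∀ n, m (spanningSets m n) = 0 := fun n => by
    by_contra hne
    have hle := hr.setLIntegral_lintegral_le ht hF (spanningSets m n)
    simp only [htop, setLIntegral_const, ENNReal.top_mul hne, top_le_iff] at hle
    exact ENNReal.add_ne_top.2 ⟨hfin, (measure_spanningSets_lt_top m n).ne⟩ hle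
  have hm : m = 0 := by
    rw [← Measure.measure_univ_eq_zero, ← iUnion_spanningSets m]
    exact measure_iUnion_null hspan
  obtain ⟨x⟩ := ‹Nonempty X›
  simpa [hm] using hr.integral_eq_one t ht x

end IsHeatKernel

end Kernel

section Harnack

variable {X : Type*} [MeasurableSpace X]

/-- The moment `∫ F ^ p dμ_x` of a function with respect to the members of a family of measures. -/
noncomputable def moment (μ : X → Measure X) (F : X → ℝ≥0) (p : ℝ) (x : X) : ℝ≥0∞ :=
  ∫⁻ z, (F z : ℝ≥0∞) ^ p ∂μ x

/-- The logarithm of the moment `∫ F ^ p dμ_x`; it is meaningful only where that moment is neither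
`0` nor `∞`. -/
noncomputable def logMoment (μ : X → Measure X) (F : X → ℝ≥0) (p : ℝ) (x : X) : ℝ :=
  Real.log (moment μ F p x).toReal

/-- Standing assumptions on `F`: it does not vanish almost everywhere, and one of its moments of
order `p₀ > 1` is finite somewhere. -/
structure HasFiniteMoment (μ : X → Measure X) (F : X → ℝ≥0) (p₀ : ℝ) : Prop where
  measurable : Measurable F
  one_lt : 1 < p₀
  ne_zero : ∃ w, moment μ F 1 w ≠ 0
  ne_top : ∃ y, moment μ F p₀ y ≠ ∞

variable {μ : X → Measure X} {F : X → ℝ≥0} {p₀ : ℝ}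

theorem moment_one (x : X) : moment μ F 1 x = ∫⁻ z, F z ∂μ x := by
  simp only [moment, ENNReal.rpow_one]

theorem moment_rpow {q : ℝ} (hq : 0 ≤ q) (p : ℝ) (x : X) :
    moment μ (fun z => F z ^ q) p x = moment μ F (q * p) x := by
  simp only [moment, ENNReal.coe_rpow_of_nonneg _ hq, ← ENNReal.rpow_mul]

theorem toReal_moment (hF : Measurable F) {p : ℝ} (hp : 0 ≤ p) (x : X) :
    (moment μ F p x).toReal = ∫ z, (F z : ℝ) ^ p ∂μ x := by
  rw [integral_eq_lintegral_of_nonneg_ae (Eventually.of_forall fun z => by positivity)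
    (hF.coe_nnreal_real.pow_const p).aestronglyMeasurable]
  refine congrArg _ (lintegral_congr fun z => ?_)
  rw [← NNReal.coe_rpow, ENNReal.ofReal_coe_nnreal, ENNReal.coe_rpow_of_nonneg _ hp]

theorem toReal_moment_one (hF : Measurable F) (x : X) :
    (moment μ F 1 x).toReal = ∫ z, (F z : ℝ) ∂μ x := by
  simp only [toReal_moment hF zero_le_one, Real.rpow_one]

theorem moment_add_le (hF : Measurable F) {a b α β : ℝ} (ha : 0 ≤ a) (hb : 0 ≤ b) (hα : 0 ≤ α)
    (hβ : 0 ≤ β) (hαβ : α + β = 1) (x : X) :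
    moment μ F (α * a + β * b) x ≤ moment μ F a x ^ α * moment μ F b x ^ β := by
  refine le_trans (le_of_eq (lintegral_congr fun z => ?_)) (ENNReal.lintegral_mul_norm_pow_le
    (hF.coe_nnreal_ennreal.pow_const a).aemeasurable
    (hF.coe_nnreal_ennreal.pow_const b).aemeasurable hα hβ hαβ)
  rw [← ENNReal.rpow_mul, ← ENNReal.rpow_mul, mul_comm a, mul_comm b,
    ENNReal.rpow_add_of_nonneg _ _ (mul_nonneg hα ha) (mul_nonneg hβ hb)]

variable [PseudoMetricSpace X]

/-- A family of mutually absolutely continuous probability measures indexed by the points of the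
space that satisfies the dimension-free Harnack inequality, with `κ` in the place of
`2K / (e^{2Kt} - 1)`. -/
structure HarnackFamily (μ : X → Measure X) (κ : ℝ) : Prop where
  prob : ∀ x, IsProbabilityMeasure (μ x)
  ac : ∀ x y, μ x ≪ μ y
  nonneg : 0 ≤ κ
  harnack : ∀ p : ℝ, 1 < p → ∀ F : X → ℝ≥0, Measurable F → ∀ x y,
    (∫⁻ z, F z ∂μ x) ^ p ≤ (∫⁻ z, (F z : ℝ≥0∞) ^ p ∂μ y) *
      ENNReal.ofReal (Real.exp (p * κ * dist x y ^ 2 / (4 * (p - 1))))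

namespace HarnackFamily

variable {κ : ℝ}

theorem moment_rpow_le (hμ : HarnackFamily μ κ) (hF : Measurable F) {p s : ℝ} (hp : 0 ≤ p)
    (hs : 1 < s) (x y : X) :
    moment μ F p x ^ s ≤ moment μ F (p * s) y *
      ENNReal.ofReal (Real.exp (s * κ * dist x y ^ 2 / (4 * (s - 1)))) := by
  have h := hμ.harnack s hs (fun z => F z ^ p) (hF.pow_const p) x y
  simpa only [moment, ENNReal.coe_rpow_of_nonneg _ hp, ← ENNReal.rpow_mul] using h

theorem moment_ne_zero (hμ : HarnackFamily μ κ) (hF : HasFiniteMoment μ F p₀) (p : ℝ) (x : X) :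
    moment μ F p x ≠ 0 := by
  obtain ⟨w, hw⟩ := hF.ne_zero
  have hmeas := hF.measurable.coe_nnreal_ennreal
  contrapose! hw
  rw [moment, lintegral_eq_zero_iff (hmeas.pow_const p)] at hw
  rw [moment, lintegral_eq_zero_iff (hmeas.pow_const 1)]
  filter_upwards [(hμ.ac w x).ae_le hw] with z hz
  simp only [Pi.zero_apply, ENNReal.rpow_eq_zero_iff, ENNReal.coe_ne_top, false_and, or_false]
    at hz ⊢
  exact ⟨hz.1, one_pos⟩

theorem moment_ne_top (hμ : HarnackFamily μ κ) (hF : HasFiniteMoment μ F p₀) {p : ℝ} (hp : 0 < p)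
    (hpp : p < p₀) (x : X) : moment μ F p x ≠ ∞ := by
  obtain ⟨y, hy⟩ := hF.ne_top
  have h := hμ.moment_rpow_le hF.measurable hp.le ((one_lt_div hp).2 hpp) x y
  rw [mul_div_cancel₀ _ hp.ne'] at h
  have hfin := ne_top_of_le_ne_top (ENNReal.mul_ne_top hy ENNReal.ofReal_ne_top) h
  exact fun htop => hfin (htop ▸ ENNReal.top_rpow_of_pos (div_pos (hp.trans hpp) hp))

theorem toReal_moment_pos (hμ : HarnackFamily μ κ) (hF : HasFiniteMoment μ F p₀) {p : ℝ}
    (hp : 0 < p) (hpp : p < p₀) (x : X) : 0 < (moment μ F p x).toReal :=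
  ENNReal.toReal_pos (hμ.moment_ne_zero hF p x) (hμ.moment_ne_top hF hp hpp x)

theorem exp_logMoment (hμ : HarnackFamily μ κ) (hF : HasFiniteMoment μ F p₀) {p : ℝ}
    (hp : 0 < p) (hpp : p < p₀) (x : X) :
    Real.exp (logMoment μ F p x) = (moment μ F p x).toReal :=
  Real.exp_log (hμ.toReal_moment_pos hF hp hpp x)

theorem hasFiniteMoment_rpow (hμ : HarnackFamily μ κ) (hF : HasFiniteMoment μ F p₀)
    {q : ℝ} (hq : 0 < q) (hqp : q < p₀) : HasFiniteMoment μ (fun z => F z ^ q) (p₀ / q) where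
  measurable := hF.measurable.pow_const q
  one_lt := (one_lt_div hq).2 hqp
  ne_zero := hF.ne_zero.imp fun w _ => by
    simpa only [moment_rpow hq.le] using hμ.moment_ne_zero hF (q * 1) w
  ne_top := hF.ne_top.imp fun y hy => by
    rwa [moment_rpow hq.le, mul_div_cancel₀ _ hq.ne']

theorem mul_logMoment_le (hμ : HarnackFamily μ κ) (hF : HasFiniteMoment μ F p₀)
    {p s : ℝ} (hp : 0 < p) (hs : 1 < s) (hps : p * s < p₀) (x y : X) :
    s * logMoment μ F p x ≤
      logMoment μ F (p * s) y + s * κ * dist x y ^ 2 / (4 * (s - 1)) := by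
  have hps0 : 0 < p * s := mul_pos hp (one_pos.trans hs)
  have hx := hμ.toReal_moment_pos hF hp ((le_mul_of_one_le_right hp.le hs.le).trans_lt hps) x
  have hy := hμ.toReal_moment_pos hF hps0 hps y
  have h := ENNReal.toReal_mono
    (ENNReal.mul_ne_top (hμ.moment_ne_top hF hps0 hps y) ENNReal.ofReal_ne_top)
    (hμ.moment_rpow_le hF.measurable hp.le hs x y)
  rw [ENNReal.toReal_mul, ← ENNReal.toReal_rpow, ENNReal.toReal_ofReal (Real.exp_pos _).le] at h
  have hlog := Real.log_le_log (Real.rpow_pos_of_pos hx s) h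
  rwa [Real.log_rpow hx, Real.log_mul hy.ne' (Real.exp_pos _).ne', Real.log_exp] at hlog

theorem convexOn_logMoment (hμ : HarnackFamily μ κ) (hF : HasFiniteMoment μ F p₀) (x : X) :
    ConvexOn ℝ (Ioo 0 p₀) fun p => logMoment μ F p x := by
  refine ⟨convex_Ioo 0 p₀, fun a ha b hb α β hα hβ hαβ => ?_⟩
  have hc := convex_Ioo 0 p₀ ha hb hα hβ hαβ
  simp only [smul_eq_mul] at hc ⊢
  have hA := hμ.toReal_moment_pos hF ha.1 ha.2 x
  have hB := hμ.toReal_moment_pos hF hb.1 hb.2 x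
  have h := ENNReal.toReal_mono (ENNReal.mul_ne_top
    (ENNReal.rpow_ne_top_of_nonneg hα (hμ.moment_ne_top hF ha.1 ha.2 x))
    (ENNReal.rpow_ne_top_of_nonneg hβ (hμ.moment_ne_top hF hb.1 hb.2 x)))
    (moment_add_le hF.measurable ha.1.le hb.1.le hα hβ hαβ x)
  rw [ENNReal.toReal_mul, ← ENNReal.toReal_rpow, ← ENNReal.toReal_rpow] at h
  have hlog := Real.log_le_log (hμ.toReal_moment_pos hF hc.1 hc.2 x) h
  rwa [Real.log_mul (Real.rpow_pos_of_pos hA _).ne' (Real.rpow_pos_of_pos hB _).ne',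
    Real.log_rpow hA, Real.log_rpow hB] at hlog

-- The Harnack inequality with exponent `1 + η`, where `log ∫ F ^ (1 + η)` is bounded by convexity.
theorem logMoment_sub_le (hμ : HarnackFamily μ κ) (hF : HasFiniteMoment μ F p₀) {η δ : ℝ}
    (hη : 0 < η) (hηδ : η ≤ δ) (hδp : 1 + δ < p₀) (x y : X) :
    logMoment μ F 1 x - logMoment μ F 1 y ≤
      η * ((logMoment μ F (1 + δ) y - logMoment μ F 1 y) / δ - logMoment μ F 1 x) +
        (1 + η) * κ * dist x y ^ 2 / (4 * η) := by
  have hharnack := hμ.mul_logMoment_le hF one_pos (lt_add_of_pos_right 1 hη) (by linarith) x y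
  have hsecant := (hμ.convexOn_logMoment hF y).secant_mono (a := 1) (x := 1 + η) (y := 1 + δ)
    ⟨one_pos, hF.one_lt⟩ ⟨by linarith, by linarith⟩ ⟨by linarith, hδp⟩ (by linarith) (by linarith)
    (by linarith)
  simp only [add_sub_cancel_left, one_mul] at hharnack hsecant
  rw [div_le_iff₀ hη] at hsecant
  linarith

theorem exists_abs_logMoment_le (hμ : HarnackFamily μ κ) (hF : HasFiniteMoment μ F p₀) {p : ℝ}
    (hp : 0 < p) (hpp : p < p₀) {B : Set X} (hB : Bornology.IsBounded B) :
    ∃ M, ∀ x ∈ B, |logMoment μ F p x| ≤ M := by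
  rcases B.eq_empty_or_nonempty with rfl | ⟨b, hb⟩
  · exact ⟨0, by simp⟩
  obtain ⟨s, hs, hsp⟩ := exists_between ((one_lt_div hp).2 hpp)
  rw [lt_div_iff₀ hp, mul_comm] at hsp
  have hs0 : 0 < s := one_pos.trans hs
  obtain ⟨c, hc⟩ : ∃ c, ∀ x ∈ B, ∀ y ∈ B, s * κ * dist x y ^ 2 / (4 * (s - 1)) ≤ c := by
    refine ⟨s * κ * Metric.diam B ^ 2 / (4 * (s - 1)), fun x hx y hy => ?_⟩
    have := Metric.dist_le_diam_of_mem hB hx hy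
    have := hμ.nonneg
    have := sub_pos.2 hs
    gcongr
  have hupper : ∀ x ∈ B, logMoment μ F p x ≤ (logMoment μ F (p * s) b + c) / s := fun x hx => by
    rw [le_div_iff₀' hs0]
    exact (hμ.mul_logMoment_le hF hp hs hsp x b).trans (add_le_add_right (hc x hx b hb) _)
  have hlower : ∀ x ∈ B, s * logMoment μ F (p / s) b - c ≤ logMoment μ F p x := fun x hx => by
    have h := hμ.mul_logMoment_le hF (div_pos hp hs0) hs (by rwa [div_mul_cancel₀ _ hs0.ne']) b x
    rw [div_mul_cancel₀ _ hs0.ne'] at h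
    linarith [hc b hb x hx]
  exact ⟨_, fun x hx => abs_le_max_abs_abs (hlower x hx) (hupper x hx)⟩

theorem exists_lipschitzOnWith_logMoment (hμ : HarnackFamily μ κ) (hF : HasFiniteMoment μ F p₀)
    {δ M : ℝ} (hδ : 0 < δ) (hδp : 1 + δ < p₀) {B : Set X}
    (hM : ∀ x ∈ B, |logMoment μ F 1 x| ≤ M) (hMδ : ∀ x ∈ B, |logMoment μ F (1 + δ) x| ≤ M) :
    ∃ C : ℝ≥0, LipschitzOnWith C (logMoment μ F 1) B := by
  refine ⟨Real.toNNReal (2 * M / δ + M + (1 + δ) * κ / 4),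
    LipschitzOnWith.of_le_add_mul _ fun x hx y hy => ?_⟩
  have hx1 := abs_le.1 (hM x hx)
  have hy1 := abs_le.1 (hM y hy)
  have hyδ := abs_le.1 (hMδ y hy)
  have hκ := hμ.nonneg
  have hM0 : 0 ≤ M := (abs_nonneg _).trans (hM x hx)
  have hslope : (logMoment μ F (1 + δ) y - logMoment μ F 1 y) / δ ≤ 2 * M / δ := by
    gcongr; linarith
  rw [← sub_le_iff_le_add', Real.coe_toNNReal _ (by positivity), mul_comm]
  suffices h : ∀ η > dist x y, logMoment μ F 1 x - logMoment μ F 1 y ≤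
      η * (2 * M / δ + M + (1 + δ) * κ / 4) from
    ge_of_tendsto ((continuous_mul_const _).continuousWithinAt (s := Ioi (dist x y)))
      (eventually_mem_nhdsWithin.mono h)
  intro η hη
  have hη0 : 0 < η := dist_nonneg.trans_lt hη
  rcases le_total η δ with hηδ | hδη
  · have hsq : (1 + η) * κ * dist x y ^ 2 / (4 * η) ≤ (1 + δ) * κ * η ^ 2 / (4 * η) := by
      gcongr
    calc _ ≤ _ := hμ.logMoment_sub_le hF hη0 hηδ hδp x y
      _ ≤ η * (2 * M / δ + M) + (1 + δ) * κ * η ^ 2 / (4 * η) := by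
        gcongr; linarith
      _ = _ := by field_simp
  · calc _ ≤ 2 * M := by linarith
      _ = δ * (2 * M / δ) := by field_simp
      _ ≤ _ := by
        rw [add_assoc]
        gcongr
        exact le_add_of_nonneg_right (by positivity)

theorem exists_lipschitzOnWith_moment (hμ : HarnackFamily μ κ) (hF : HasFiniteMoment μ F p₀)
    {δ M : ℝ} (hδ : 0 < δ) (hδp : 1 + δ < p₀) {B : Set X}
    (hM : ∀ x ∈ B, |logMoment μ F 1 x| ≤ M) (hMδ : ∀ x ∈ B, |logMoment μ F (1 + δ) x| ≤ M) :
    ∃ C : ℝ≥0, LipschitzOnWith C (fun x => (moment μ F 1 x).toReal) B := by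
  obtain ⟨C, hC⟩ := hμ.exists_lipschitzOnWith_logMoment hF hδ hδp hM hMδ
  have hexp : LipschitzOnWith (Real.toNNReal (Real.exp M)) Real.exp (Iic M) :=
    (convex_Iic M).lipschitzOnWith_of_nnnorm_deriv_le (fun _ _ => Real.differentiableAt_exp)
      fun x hx => by
        rw [Real.deriv_exp, ← NNReal.coe_le_coe, coe_nnnorm, Real.norm_eq_abs, Real.abs_exp]
        exact (Real.exp_le_exp.2 hx).trans (Real.le_coe_toNNReal _)
  have hcomp := hexp.comp hC fun x hx => (abs_le.1 (hM x hx)).2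
  simp only [Function.comp_def, hμ.exp_logMoment hF one_pos hF.one_lt] at hcomp
  exact ⟨_, hcomp⟩

theorem isLipschitzOnBounded (hμ : HarnackFamily μ κ) (hF : HasFiniteMoment μ F p₀) :
    IsLipschitzOnBounded fun x => (moment μ F 1 x).toReal := by
  intro B hB
  obtain ⟨q, hq, hqp⟩ := exists_between hF.one_lt
  obtain ⟨M₁, hM₁⟩ := hμ.exists_abs_logMoment_le hF one_pos hF.one_lt hB
  obtain ⟨M₂, hM₂⟩ := hμ.exists_abs_logMoment_le hF (one_pos.trans hq) hqp hB
  rw [← add_sub_cancel 1 q] at hqp hM₂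
  exact hμ.exists_lipschitzOnWith_moment hF (sub_pos.2 hq) hqp
    (fun x hx => (hM₁ x hx).trans (le_max_left _ M₂))
    fun x hx => (hM₂ x hx).trans (le_max_right M₁ _)

theorem continuous_logMoment (hμ : HarnackFamily μ κ) (hF : HasFiniteMoment μ F p₀)
    {q : ℝ} (hq : 0 < q) (hqp : q < p₀) : Continuous (logMoment μ F q) := by
  have h := (hμ.isLipschitzOnBounded (hμ.hasFiniteMoment_rpow hF hq hqp)).continuous
  simp only [moment_rpow hq.le, mul_one] at h
  exact h.log fun x => (hμ.toReal_moment_pos hF hq hqp x).ne'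

end HarnackFamily

end Harnack

section LipCalculus

theorem lip_le_of_tendsto {X Y : Type*} [PseudoEMetricSpace X] [PseudoEMetricSpace Y] {f : X → Y}
    {x : X} {q : X → ℝ≥0∞} {c : ℝ≥0∞} (hq : Tendsto q (𝓝[≠] x) (𝓝 c))
    (h : ∀ᶠ y in 𝓝[≠] x, edist (f y) (f x) ≤ q y * edist y x) : lip f x ≤ c := by
  rcases (𝓝[≠] x).eq_or_neBot with hbot | hbot
  · simp only [lip, hbot, limsup_bot, bot_le]
  · exact (limsup_le_limsup (h.mono fun _ => ENNReal.div_le_of_le_mul)).trans hq.limsup_eq.le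

theorem lip_le_enorm_deriv {E : Type*} [NormedAddCommGroup E] [NormedSpace ℝ E] {f : ℝ → E}
    {f' : E} {x : ℝ} (hf : HasDerivAt f f' x) : lip f x ≤ ‖f'‖ₑ := by
  refine lip_le_of_tendsto (hasDerivAt_iff_tendsto_slope.1 hf).enorm (Eventually.of_forall
    fun y => ?_)
  rw [edist_eq_enorm_sub, edist_eq_enorm_sub, mul_comm, ← enorm_smul, sub_smul_slope, vsub_eq_sub]

end LipCalculus

section MomentDerivative

open ProbabilityTheory

variable {X : Type*} [MeasurableSpace X] {ν : Measure X} {F : X → ℝ≥0} {a b q : ℝ}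

theorem exp_mul_log_ae_eq_rpow (ν : Measure X) (hF : Measurable F) (p : ℝ) :
    (fun z => Real.exp (p * Real.log (F z))) =ᵐ[ν.restrict {z | F z ≠ 0}]
      fun z => (F z : ℝ) ^ p :=
  ae_restrict_of_forall_mem (hF (measurableSet_singleton 0).compl) fun z hz => by
    simp only [Real.rpow_def_of_pos (NNReal.coe_pos.2 (pos_iff_ne_zero.2 hz)), mul_comm]

theorem mgf_log_eq_integral_rpow (ν : Measure X) (hF : Measurable F) {p : ℝ} (hp : p ≠ 0) :
    mgf (fun z => Real.log (F z)) (ν.restrict {z | F z ≠ 0}) p = ∫ z, (F z : ℝ) ^ p ∂ν := by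
  rw [mgf, integral_congr_ae (exp_mul_log_ae_eq_rpow ν hF p)]
  refine setIntegral_eq_integral_of_forall_compl_eq_zero fun z hz => ?_
  rw [not_not.1 hz, NNReal.coe_zero, Real.zero_rpow hp]

theorem mem_interior_integrableExpSet_log (hF : Measurable F) (hq : q ∈ Ioo a b)
    (h : ∀ p ∈ Ioo a b, Integrable (fun z => (F z : ℝ) ^ p) ν) :
    q ∈ interior (integrableExpSet (fun z => Real.log (F z)) (ν.restrict {z | F z ≠ 0})) :=
  mem_interior.2 ⟨Ioo a b, fun p hp =>
    ((h p hp).restrict).congr (exp_mul_log_ae_eq_rpow ν hF p).symm, isOpen_Ioo, hq⟩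

theorem log_mul_exp_ae_eq (ν : Measure X) (hF : Measurable F) (p : ℝ) :
    (fun z => Real.log (F z) * Real.exp (p * Real.log (F z))) =ᵐ[ν.restrict {z | F z ≠ 0}]
      fun z => (F z : ℝ) ^ p * Real.log (F z) :=
  (exp_mul_log_ae_eq_rpow ν hF p).mono fun z hz => by simp only [hz, mul_comm]

theorem integrable_rpow_mul_log (hF : Measurable F) (hq : q ∈ Ioo a b)
    (h : ∀ p ∈ Ioo a b, Integrable (fun z => (F z : ℝ) ^ p) ν) :
    Integrable (fun z => (F z : ℝ) ^ q * Real.log (F z)) ν := by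
  have hint := (integrable_pow_mul_exp_of_mem_interior_integrableExpSet
    (mem_interior_integrableExpSet_log hF hq h) 1).congr
    (by simpa only [pow_one] using log_mul_exp_ae_eq ν hF q)
  refine (integrableOn_iff_integrable_of_support_subset fun z hz => ?_).1 hint
  rintro h0
  simp [h0] at hz

theorem hasDerivAt_integral_rpow (hF : Measurable F) (ha : 0 ≤ a) (hq : q ∈ Ioo a b)
    (h : ∀ p ∈ Ioo a b, Integrable (fun z => (F z : ℝ) ^ p) ν) :
    HasDerivAt (fun p => ∫ z, (F z : ℝ) ^ p ∂ν) (∫ z, (F z : ℝ) ^ q * Real.log (F z) ∂ν) q := by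
  have hderiv := hasDerivAt_mgf (mem_interior_integrableExpSet_log hF hq h)
  rw [integral_congr_ae (log_mul_exp_ae_eq ν hF q),
    setIntegral_eq_integral_of_forall_compl_eq_zero fun z hz => by simp [not_not.1 hz]] at hderiv
  refine hderiv.congr_of_eventuallyEq ?_
  filter_upwards [lt_mem_nhds (ha.trans_lt hq.1)] with p hp
  exact (mgf_log_eq_integral_rpow ν hF hp.ne').symm

end MomentDerivative

section Entropy

variable {X : Type*} [PseudoMetricSpace X] [MeasurableSpace X] {μ : X → Measure X} {κ : ℝ}
  {F : X → ℝ≥0} {p₀ : ℝ}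

namespace HarnackFamily

theorem integrable_rpow (hμ : HarnackFamily μ κ) (hF : HasFiniteMoment μ F p₀) (x : X) :
    ∀ p ∈ Ioo 0 p₀, Integrable (fun z => (F z : ℝ) ^ p) (μ x) := fun p hp => by
  refine ⟨(hF.measurable.coe_nnreal_real.pow_const p).aestronglyMeasurable,
    (lintegral_congr fun z => ?_).trans_lt (hμ.moment_ne_top hF hp.1 hp.2 x).lt_top⟩
  simp only [← NNReal.coe_rpow, NNReal.enorm_eq, ENNReal.coe_rpow_of_nonneg _ hp.1.le]

theorem integrable (hμ : HarnackFamily μ κ) (hF : HasFiniteMoment μ F p₀) (x : X) :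
    Integrable (fun z => (F z : ℝ)) (μ x) := by
  simpa only [Real.rpow_one] using hμ.integrable_rpow hF x 1 ⟨one_pos, hF.one_lt⟩

theorem integrable_mul_log (hμ : HarnackFamily μ κ) (hF : HasFiniteMoment μ F p₀) (x : X) :
    Integrable (fun z => (F z : ℝ) * Real.log (F z)) (μ x) := by
  simpa only [Real.rpow_one] using
    integrable_rpow_mul_log hF.measurable ⟨one_pos, hF.one_lt⟩ (hμ.integrable_rpow hF x)

theorem hasDerivAt_logMoment (hμ : HarnackFamily μ κ) (hF : HasFiniteMoment μ F p₀) (x : X) :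
    HasDerivAt (fun p => logMoment μ F p x)
      ((∫ z, F z * Real.log (F z) ∂μ x) / (moment μ F 1 x).toReal) 1 := by
  have hderiv := hasDerivAt_integral_rpow hF.measurable le_rfl ⟨one_pos, hF.one_lt⟩
    (hμ.integrable_rpow hF x)
  simp only [Real.rpow_one] at hderiv
  refine HasDerivAt.log (hderiv.congr_of_eventuallyEq ?_)
    (hμ.toReal_moment_pos hF one_pos hF.one_lt x).ne'
  filter_upwards [lt_mem_nhds one_pos] with p hp
  exact toReal_moment hF.measurable hp.le x

theorem moment_mul_logMoment_le (hμ : HarnackFamily μ κ) (hF : HasFiniteMoment μ F p₀) (x : X) :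
    (moment μ F 1 x).toReal * logMoment μ F 1 x ≤ ∫ z, F z * Real.log (F z) ∂μ x := by
  have := hμ.prob x
  rw [logMoment, toReal_moment_one hF.measurable]
  exact Real.convexOn_mul_log.map_integral_le Real.continuous_mul_log.continuousOn isClosed_Ici
    (Eventually.of_forall fun z => (F z).2) (hμ.integrable hF x) (hμ.integrable_mul_log hF x)

theorem logMoment_sub_le_mul_dist (hμ : HarnackFamily μ κ) (hF : HasFiniteMoment μ F p₀)
    {α δ : ℝ} (hα : 0 < α) (hδp : 1 + δ < p₀) {x y : X} (hxy : 0 < dist x y)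
    (hδ : α * dist x y ≤ δ) :
    logMoment μ F 1 x - logMoment μ F 1 y ≤
      (α * ((logMoment μ F (1 + δ) y - logMoment μ F 1 y) / δ - logMoment μ F 1 x) +
        (1 + α * dist x y) * κ / (4 * α)) * dist x y := by
  refine (hμ.logMoment_sub_le hF (mul_pos hα hxy) hδ hδp x y).trans_eq ?_
  field_simp

theorem lip_logMoment_le_secant (hμ : HarnackFamily μ κ) (hF : HasFiniteMoment μ F p₀) (x : X)
    {α δ : ℝ} (hα : 0 < α) (hδ : 0 < δ) (hδp : 1 + δ < p₀) :
    lip (logMoment μ F 1) x ≤ ENNReal.ofReal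
      (α * ((logMoment μ F (1 + δ) x - logMoment μ F 1 x) / δ - logMoment μ F 1 x) +
        κ / (4 * α)) := by
  have hcont := hμ.continuous_logMoment hF one_pos hF.one_lt
  have hcontδ := hμ.continuous_logMoment hF (by linarith : 0 < 1 + δ) hδp
  let Q : X → X → ℝ := fun a b =>
    α * ((logMoment μ F (1 + δ) b - logMoment μ F 1 b) / δ - logMoment μ F 1 a) +
      (1 + α * dist a b) * κ / (4 * α)
  have hQ : Tendsto (fun y => ENNReal.ofReal (max (Q y x) (Q x y))) (𝓝[≠] x)
      (𝓝 (ENNReal.ofReal (Q x x))) := by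
    have hmax : Continuous fun y => ENNReal.ofReal (max (Q y x) (Q x y)) := by
      simp only [Q]
      exact ENNReal.continuous_ofReal.comp (by fun_prop)
    simpa only [max_self] using hmax.continuousWithinAt.tendsto (x := x)
  have hnear : ∀ᶠ y in 𝓝 x, α * dist y x < δ :=
    ((continuous_const.mul (continuous_id.dist continuous_const)).tendsto' x 0
      (by simp)).eventually_lt_const hδ
  refine (lip_le_of_tendsto hQ ?_).trans_eq
    (by simp only [Q, dist_self, mul_zero, add_zero, one_mul])
  filter_upwards [nhdsWithin_le_nhds hnear] with y hy
  rcases dist_nonneg.eq_or_lt' (a := dist y x) with h0 | hpos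
  · rw [((Metric.inseparable_iff.2 h0).map hcont).eq, edist_self]
    exact zero_le
  · rw [edist_dist, edist_dist, ← ENNReal.ofReal_mul' dist_nonneg, Real.dist_eq]
    refine ENNReal.ofReal_le_ofReal (abs_sub_le_iff.2 ⟨?_, ?_⟩)
    · exact (hμ.logMoment_sub_le_mul_dist hF hα hδp hpos hy.le).trans
        (mul_le_mul_of_nonneg_right (le_max_left _ _) hpos.le)
    · rw [dist_comm] at hpos hy ⊢
      exact (hμ.logMoment_sub_le_mul_dist hF hα hδp hpos hy.le).trans
        (mul_le_mul_of_nonneg_right (le_max_right _ _) hpos.le)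

theorem lip_logMoment_le (hμ : HarnackFamily μ κ) (hF : HasFiniteMoment μ F p₀) (x : X) {α : ℝ}
    (hα : 0 < α) :
    lip (logMoment μ F 1) x ≤ ENNReal.ofReal
      (α * ((∫ z, F z * Real.log (F z) ∂μ x) / (moment μ F 1 x).toReal - logMoment μ F 1 x) +
        κ / (4 * α)) := by
  have hslope := (hasDerivAt_iff_tendsto_slope_zero.1 (hμ.hasDerivAt_logMoment hF x)).mono_left
    (nhdsGT_le_nhdsNE 0)
  refine ge_of_tendsto (ENNReal.tendsto_ofReal
    (((hslope.sub_const _).const_mul α).add_const _)) ?_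
  filter_upwards [Ioo_mem_nhdsGT (sub_pos.2 hF.one_lt)] with δ hδ
  simpa only [smul_eq_mul, div_eq_inv_mul] using
    hμ.lip_logMoment_le_secant hF x hα hδ.1 (by linarith [hδ.2])

end HarnackFamily

theorem sq_le_mul_of_forall_le {b c l : ℝ} (hb : 0 ≤ b) (hc : 0 ≤ c) (hl : 0 ≤ l)
    (h : ∀ α > 0, l ≤ α * b + c / (4 * α)) : l ^ 2 ≤ c * b := by
  have hquad : ∀ α : ℝ, 0 ≤ 4 * b * (α * α) + -(4 * l) * α + c := fun α => by
    rcases le_or_gt α 0 with hα | hα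
    · nlinarith [mul_nonneg hb (mul_self_nonneg α), mul_nonneg hl (neg_nonneg.2 hα)]
    · have := mul_le_mul_of_nonneg_left (h α hα) (by positivity : 0 ≤ 4 * α)
      rw [mul_add, mul_div_cancel₀ _ (by positivity)] at this
      linarith
  have := discrim_le_zero hquad
  rw [discrim] at this
  linarith

namespace HarnackFamily

theorem lip_logMoment_sq_le (hμ : HarnackFamily μ κ) (hF : HasFiniteMoment μ F p₀) (x : X) :
    lip (logMoment μ F 1) x ^ 2 ≤ ENNReal.ofReal (κ *
      ((∫ z, F z * Real.log (F z) ∂μ x) / (moment μ F 1 x).toReal - logMoment μ F 1 x)) := by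
  have hent : 0 ≤
      (∫ z, F z * Real.log (F z) ∂μ x) / (moment μ F 1 x).toReal - logMoment μ F 1 x := by
    rw [sub_nonneg, le_div_iff₀' (hμ.toReal_moment_pos hF one_pos hF.one_lt x)]
    exact hμ.moment_mul_logMoment_le hF x
  have hκ := hμ.nonneg
  lift lip (logMoment μ F 1) x to ℝ≥0 using
    ne_top_of_le_ne_top ENNReal.ofReal_ne_top (hμ.lip_logMoment_le hF x one_pos) with l hl
  rw [← ENNReal.coe_pow, ← ENNReal.ofReal_coe_nnreal, NNReal.coe_pow]
  refine ENNReal.ofReal_le_ofReal (sq_le_mul_of_forall_le hent hκ l.2 fun α hα => ?_)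
  have hα' := hμ.lip_logMoment_le hF x hα
  rwa [← hl, ← ENNReal.ofReal_coe_nnreal, ENNReal.ofReal_le_ofReal_iff (by positivity)] at hα'

theorem lip_moment_sq_le (hμ : HarnackFamily μ κ) (hF : HasFiniteMoment μ F p₀) (x : X) :
    lip (fun y => (moment μ F 1 y).toReal) x ^ 2 ≤
      ENNReal.ofReal (κ * (moment μ F 1 x).toReal * ((∫ z, F z * Real.log (F z) ∂μ x) -
        (moment μ F 1 x).toReal * Real.log (moment μ F 1 x).toReal)) := by
  have hpos := hμ.toReal_moment_pos hF one_pos hF.one_lt x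
  have hlip := lip_le_enorm_deriv (Real.hasDerivAt_exp (logMoment μ F 1 x))
  have hchain := lip_comp_le (hμ.continuous_logMoment hF one_pos hF.one_lt).continuousAt
    (ne_top_of_le_ne_top enorm_ne_top hlip)
    (ne_top_of_le_ne_top ENNReal.ofReal_ne_top (hμ.lip_logMoment_le hF x one_pos))
  rw [Real.enorm_eq_ofReal (Real.exp_pos _).le] at hlip
  simp only [hμ.exp_logMoment hF one_pos hF.one_lt] at hlip hchain
  calc _ ≤ (ENNReal.ofReal (moment μ F 1 x).toReal * lip (logMoment μ F 1) x) ^ 2 := by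
        gcongr; exact hchain.trans (mul_le_mul_left hlip _)
    _ ≤ ENNReal.ofReal (moment μ F 1 x).toReal ^ 2 * ENNReal.ofReal (κ * (_ - _)) := by
        rw [mul_pow]; gcongr; exact hμ.lip_logMoment_sq_le hF x
    _ = _ := by
        rw [← ENNReal.ofReal_pow hpos.le, ← ENNReal.ofReal_mul (by positivity), logMoment]
        field_simp

end HarnackFamily

end Entropy

section BoundedMoments

variable {X : Type*} [MeasurableSpace X] {μ : X → Measure X} {F : X → ℝ≥0} {x : X} {p : ℝ}

theorem one_le_moment [IsProbabilityMeasure (μ x)] (hF : ∀ᵐ z ∂μ x, 1 ≤ F z) (hp : 0 < p) :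
    1 ≤ moment μ F p x := by
  calc (1 : ℝ≥0∞) = ∫⁻ _, 1 ∂μ x := by rw [lintegral_one, measure_univ]
    _ ≤ moment μ F p x := lintegral_mono_ae
      (hF.mono fun z hz => ENNReal.one_le_rpow (ENNReal.one_le_coe_iff.2 hz) hp)

theorem moment_le_rpow [IsProbabilityMeasure (μ x)] {C : ℝ≥0} (hF : ∀ᵐ z ∂μ x, F z ≤ C)
    (hp : 0 ≤ p) : moment μ F p x ≤ ((C ^ p : ℝ≥0) : ℝ≥0∞) := by
  calc moment μ F p x ≤ ∫⁻ _, (C : ℝ≥0∞) ^ p ∂μ x := lintegral_mono_ae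
        (hF.mono fun z hz => ENNReal.rpow_le_rpow (ENNReal.coe_le_coe.2 hz) hp)
    _ = ((C ^ p : ℝ≥0) : ℝ≥0∞) := by
        rw [lintegral_const, measure_univ, mul_one, ENNReal.coe_rpow_of_nonneg _ hp]

theorem abs_logMoment_le [IsProbabilityMeasure (μ x)] {C : ℝ≥0} (hF : ∀ᵐ z ∂μ x, 1 ≤ F z)
    (hFC : ∀ᵐ z ∂μ x, F z ≤ C) (hp : 0 < p) : |logMoment μ F p x| ≤ p * Real.log C := by
  obtain ⟨z, hz, hzC⟩ := (hF.and hFC).exists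
  have hCpos : 0 < (C : ℝ) := one_pos.trans_le (NNReal.coe_le_coe.2 (hz.trans hzC))
  have hupper := moment_le_rpow hFC hp.le
  have hlower : 1 ≤ (moment μ F p x).toReal :=
    ENNReal.toReal_mono (ne_top_of_le_ne_top ENNReal.coe_ne_top hupper) (one_le_moment hF hp)
  rw [logMoment, abs_of_nonneg (Real.log_nonneg hlower), ← Real.log_rpow hCpos]
  exact Real.log_le_log (one_pos.trans_le hlower)
    (ENNReal.toReal_mono ENNReal.coe_ne_top hupper)

variable [PseudoMetricSpace X] {κ : ℝ}

theorem HarnackFamily.hasFiniteMoment [Nonempty X] (hμ : HarnackFamily μ κ) (hFm : Measurable F)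
    {C : ℝ≥0} (hF : ∀ x, ∀ᵐ z ∂μ x, 1 ≤ F z) (hFC : ∀ x, ∀ᵐ z ∂μ x, F z ≤ C) (hp : 1 < p) :
    HasFiniteMoment μ F p := by
  obtain ⟨x⟩ := ‹Nonempty X›
  have := hμ.prob x
  exact ⟨hFm, hp, ⟨x, (one_pos.trans_le (one_le_moment (hF x) one_pos)).ne'⟩,
    ⟨x, ne_top_of_le_ne_top ENNReal.coe_ne_top
      (moment_le_rpow (hFC x) (zero_le_one.trans hp.le))⟩⟩

theorem HarnackFamily.exists_lipschitzWith_moment (hμ : HarnackFamily μ κ)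
    (hF : HasFiniteMoment μ F p) {C : ℝ≥0} (hF1 : ∀ x, ∀ᵐ z ∂μ x, 1 ≤ F z)
    (hFC : ∀ x, ∀ᵐ z ∂μ x, F z ≤ C) :
    ∃ L : ℝ≥0, LipschitzWith L fun x => (moment μ F 1 x).toReal := by
  obtain ⟨q, hq, hqp⟩ := exists_between hF.one_lt
  have hlog : ∀ s, 0 < s → s ≤ q → ∀ x ∈ univ, |logMoment μ F s x| ≤ q * Real.log C := by
    intro s hs hsq x _
    have := hμ.prob x
    obtain ⟨z, hz, hzC⟩ := ((hF1 x).and (hFC x)).exists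
    exact (abs_logMoment_le (hF1 x) (hFC x) hs).trans (mul_le_mul_of_nonneg_right hsq
      (Real.log_nonneg (NNReal.coe_le_coe.2 (hz.trans hzC))))
  obtain ⟨L, hL⟩ := hμ.exists_lipschitzOnWith_moment hF (sub_pos.2 hq)
    ((add_sub_cancel 1 q).trans_lt hqp) (hlog 1 one_pos hq.le)
    (hlog _ (by linarith) (by linarith))
  exact ⟨L, lipschitzOnWith_univ.1 hL⟩

end BoundedMoments

section HeatFlow

theorem rate_pos (K : ℝ) {t : ℝ} (ht : 0 < t) : 0 < rate K t := by
  rw [rate]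
  split_ifs with hK
  · exact one_div_pos.2 ht
  rcases lt_or_gt_of_ne hK with hneg | hpos
  · refine div_pos_of_neg_of_neg (by linarith) ?_
    rw [sub_neg, Real.exp_lt_one_iff]
    nlinarith
  · refine div_pos (by linarith) ?_
    rw [sub_pos, Real.one_lt_exp_iff]
    positivity

theorem exists_measurable_nnreal_ae_eq {X : Type*} [MeasurableSpace X] {m : Measure X} {f : X → ℝ}
    (hf : AEStronglyMeasurable f m) (h0 : 0 ≤ᵐ[m] f) :
    ∃ F : X → ℝ≥0, Measurable F ∧ f =ᵐ[m] fun z => (F z : ℝ) := by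
  refine ⟨fun z => (hf.mk f z).toNNReal, hf.stronglyMeasurable_mk.measurable.real_toNNReal, ?_⟩
  filter_upwards [hf.ae_eq_mk, h0] with z hz hz0
  rw [← hz, Real.coe_toNNReal _ hz0]

theorem exists_ae_abs_le_of_memLp_top {X : Type*} [MeasurableSpace X] {m : Measure X} {f : X → ℝ}
    (hf : MemLp f ∞ m) : ∃ M : ℝ≥0, ∀ᵐ z ∂m, |f z| ≤ M := by
  refine ⟨(eLpNorm f ∞ m).toNNReal, ?_⟩
  filter_upwards [ae_le_eLpNormEssSup (f := f) (μ := m)] with z hz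
  rw [← eLpNorm_exponent_top] at hz
  rw [← Real.norm_eq_abs, ← toReal_enorm]
  exact ENNReal.toReal_mono hf.2.ne hz

variable {X : Type*} [MeasurableSpace X] {m : Measure X} {r : ℝ → X → X → ℝ} {K t p : ℝ}
  {F : X → ℝ≥0} {f g : X → ℝ}

theorem ae_kernelMeasure_of_ae {P : X → Prop} (h : ∀ᵐ z ∂m, P z) (t : ℝ) (x : X) :
    ∀ᵐ z ∂kernelMeasure m r t x, P z :=
  (kernelMeasure_absolutelyContinuous t x).ae_le h

variable [PseudoMetricSpace X]

/-- The regularity of `h_t f`, together with the absolute convergence of the integrals defining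
`h_t f` and `h_t (f log f)` and the local logarithmic Sobolev inequality, at every point. -/
structure SatisfiesLogSobolev (m : Measure X) (r : ℝ → X → X → ℝ) (K t : ℝ) (f : X → ℝ) :
    Prop where
  isLipschitzOnBounded : IsLipschitzOnBounded (kernelFlow m r t f)
  integrable : ∀ x, Integrable (fun y => f y * r t x y) m
  integrable_mul_log : ∀ x, Integrable (fun y => f y * Real.log (f y) * r t x y) m
  lip_sq_le : ∀ x, ((lip (kernelFlow m r t f) x ^ 2 : ℝ≥0∞) : EReal) ≤
    (logSobolevBound m r K t f x : ℝ)

namespace SatisfiesLogSobolev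

theorem congr (hf : SatisfiesLogSobolev m r K t f) (hfg : f =ᵐ[m] g) :
    SatisfiesLogSobolev m r K t g := by
  have hlog : (fun y => f y * Real.log (f y)) =ᵐ[m] fun y => g y * Real.log (g y) :=
    hfg.mono fun y hy => by simp only [hy]
  refine ⟨kernelFlow_congr hfg ▸ hf.isLipschitzOnBounded,
    fun x => (hf.integrable x).congr (hfg.mono fun y hy => by simp only [hy]),
    fun x => (hf.integrable_mul_log x).congr (hlog.mono fun y hy => by simp only [hy]),
    fun x => ?_⟩
  simpa only [logSobolevBound, kernelFlow_congr hfg, kernelFlow_congr hlog] using hf.lip_sq_le x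

theorem zero : SatisfiesLogSobolev m r K t (fun _ => 0) := by
  have hflow : kernelFlow m r t (fun _ => 0) = fun _ => 0 :=
    funext fun x => by simp [kernelFlow]
  have hlip : ∀ x, lip (kernelFlow m r t fun _ => 0) x = 0 := fun x => by
    rw [hflow, ← nonpos_iff_eq_zero]
    exact lip_le_of_eventually (Eventually.of_forall fun y => by simp)
  refine ⟨fun B _ => ⟨0, ?_⟩, fun x => ?_, fun x => ?_, fun x => ?_⟩
  · rw [hflow]
    exact (LipschitzWith.const 0).lipschitzOnWith
  · simp
  · simp
  · rw [hlip]
    simp [logSobolevBound, hflow]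

theorem of_isEmpty [IsEmpty X] : SatisfiesLogSobolev m r K t f :=
  zero.congr (Eventually.of_forall fun x => isEmptyElim x)

theorem isWeakUpperGradient_lip [BorelSpace X] (hf : SatisfiesLogSobolev m r K t f) :
    IsWeakUpperGradient m (kernelFlow m r t f) (lip (kernelFlow m r t f)) :=
  hf.isLipschitzOnBounded.isWeakUpperGradient_lip

theorem minWeakUpperGradient_sq_le [BorelSpace X] [SFinite m] (hf : SatisfiesLogSobolev m r K t f) :
    ∀ᵐ x ∂m, ((minWeakUpperGradient m (kernelFlow m r t f) x ^ 2 : ℝ≥0∞) : EReal) ≤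
      (logSobolevBound m r K t f x : ℝ) := by
  filter_upwards [hf.isWeakUpperGradient_lip.isMinimalWeakUpperGradient_minWeakUpperGradient.2 _
    hf.isWeakUpperGradient_lip] with x hx
  exact (EReal.coe_ennreal_le_coe_ennreal_iff.2 (pow_le_pow_left' hx 2)).trans (hf.lip_sq_le x)

end SatisfiesLogSobolev

namespace IsHeatKernel

theorem kernelFlow_coe_eq_moment (hr : IsHeatKernel m r) (ht : 0 < t) (hF : Measurable F) :
    kernelFlow m r t (fun z => F z) =
      fun x => (moment (kernelMeasure m r t) F 1 x).toReal :=
  funext fun x => by rw [toReal_moment_one hF, hr.integral_kernelMeasure ht]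

theorem kernelFlow_add_const (hr : IsHeatKernel m r) (ht : 0 < t) (hf : MemLp f ∞ m) (c x) :
    kernelFlow m r t (fun z => f z + c) x = kernelFlow m r t f x + c := by
  have := hr.isProbabilityMeasure ht x
  obtain ⟨M, hM⟩ := exists_ae_abs_le_of_memLp_top hf
  have hint : Integrable f (kernelMeasure m r t x) :=
    .of_bound (hf.1.mono_ac (kernelMeasure_absolutelyContinuous t x)) M
      (ae_kernelMeasure_of_ae hM t x)
  simp only [← hr.integral_kernelMeasure ht, integral_add hint (integrable_const c),
    integral_const, probReal_univ, one_smul]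

variable [SigmaFinite m]

theorem lintegral_truncation_rpow_le (hr : IsHeatKernel m r) (hH : DimFreeHarnack m r K)
    (ht : 0 < t) (hp : 1 < p) (hF : Measurable F) (n : ℕ) (x y : X) :
    (∫⁻ z, truncation m F n z ∂kernelMeasure m r t x) ^ p ≤
      (∫⁻ z, (truncation m F n z : ℝ≥0∞) ^ p ∂kernelMeasure m r t y) *
        ENNReal.ofReal (Real.exp (p * rate K t * dist x y ^ 2 / (4 * (p - 1)))) := by
  have hp0 : 0 ≤ p := zero_le_one.trans hp.le
  have hG := measurable_truncation (m := m) hF n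
  have hGn := truncation_le_natCast (m := m) (F := F) n
  have hharnack := hH p hp t ht _ (memLp_truncation hF n 1) (memLp_truncation hF n ∞) x y
  simp only [NNReal.abs_eq, ← NNReal.coe_rpow, abs_of_nonneg (hr.kernelFlow_coe_nonneg ht _ x)]
    at hharnack
  have hpow := hr.lintegral_kernelMeasure_eq_ofReal ht (hG.pow_const p)
    (fun z => NNReal.rpow_le_rpow (hGn z) hp0) y
  simp only [ENNReal.coe_rpow_of_nonneg _ hp0] at hpow
  rw [hr.lintegral_kernelMeasure_eq_ofReal ht hG hGn, hpow,
    ENNReal.ofReal_rpow_of_nonneg (hr.kernelFlow_coe_nonneg ht _ x) hp0,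
    ← ENNReal.ofReal_mul' (Real.exp_pos _).le]
  exact ENNReal.ofReal_le_ofReal hharnack

theorem harnackFamily (hr : IsHeatKernel m r) (hH : DimFreeHarnack m r K) (ht : 0 < t) :
    HarnackFamily (kernelMeasure m r t) (rate K t) where
  prob := hr.isProbabilityMeasure ht
  ac x y := (kernelMeasure_absolutelyContinuous t x).trans (hr.absolutelyContinuous ht y)
  nonneg := (rate_pos K ht).le
  harnack p hp F hF x y := by
    have hp0 : 0 < p := one_pos.trans hp
    rw [← ENNReal.le_rpow_inv_iff hp0, lintegral_eq_iSup_truncation m hF]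
    refine iSup_le fun n => (ENNReal.le_rpow_inv_iff hp0).2 ?_
    refine (hr.lintegral_truncation_rpow_le hH ht hp hF n x y).trans ?_
    gcongr
    exact truncation_le n _

theorem satisfiesLogSobolev_of_hasFiniteMoment (hr : IsHeatKernel m r)
    (hH : DimFreeHarnack m r K) (ht : 0 < t) (hF : HasFiniteMoment (kernelMeasure m r t) F p) :
    SatisfiesLogSobolev m r K t fun z => F z := by
  have hμ := hr.harnackFamily hH ht
  have hflow := hr.kernelFlow_coe_eq_moment ht hF.measurable
  refine ⟨hflow ▸ hμ.isLipschitzOnBounded hF,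
    fun x => (hr.integrable_kernelMeasure_iff ht _ x).1 (hμ.integrable hF x),
    fun x => (hr.integrable_kernelMeasure_iff ht _ x).1 (hμ.integrable_mul_log hF x),
    fun x => ?_⟩
  have hent := hμ.moment_mul_logMoment_le hF x
  have hlip := hμ.lip_moment_sq_le hF x
  rw [hr.integral_kernelMeasure ht] at hent hlip
  have hnonneg : 0 ≤ logSobolevBound m r K t (fun z => F z) x := by
    rw [logSobolevBound, hflow]
    exact mul_nonneg (mul_nonneg hμ.nonneg ENNReal.toReal_nonneg) (sub_nonneg.2 hent)
  rw [← max_eq_left hnonneg, ← EReal.coe_ennreal_ofReal, logSobolevBound, hflow]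
  exact EReal.coe_ennreal_le_coe_ennreal_iff.2 hlip

theorem satisfiesLogSobolev_of_moment_ne_top (hr : IsHeatKernel m r) (hH : DimFreeHarnack m r K)
    (ht : 0 < t) (hF : Measurable F) (hfF : f =ᵐ[m] fun z => (F z : ℝ)) (hp : 1 < p) {y : X}
    (hy : moment (kernelMeasure m r t) F p y ≠ ∞) : SatisfiesLogSobolev m r K t f := by
  by_cases hzero : moment (kernelMeasure m r t) F 1 y = 0
  · rw [moment_one, lintegral_eq_zero_iff hF.coe_nnreal_ennreal] at hzero
    refine SatisfiesLogSobolev.zero.congr ?_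
    filter_upwards [hfF, (hr.absolutelyContinuous ht y).ae_le hzero] with z hz hz0
    rw [hz, ENNReal.coe_eq_zero.1 hz0, NNReal.coe_zero]
  · exact (hr.satisfiesLogSobolev_of_hasFiniteMoment hH ht
      ⟨hF, hp, ⟨y, hzero⟩, ⟨y, hy⟩⟩).congr hfF.symm

theorem satisfiesLogSobolev_of_memLp_top (hr : IsHeatKernel m r)
    (hH : DimFreeHarnack m r K) (ht : 0 < t) (hf : MemLp f ∞ m) (h0 : 0 ≤ᵐ[m] f) :
    SatisfiesLogSobolev m r K t f := by
  rcases isEmpty_or_nonempty X with _ | ⟨⟨y⟩⟩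
  · exact .of_isEmpty
  obtain ⟨F, hF, hfF⟩ := exists_measurable_nnreal_ae_eq hf.1 h0
  obtain ⟨M, hM⟩ := exists_ae_abs_le_of_memLp_top hf
  have hFM : ∀ᵐ z ∂m, F z ≤ M := by
    filter_upwards [hM, hfF] with z hz hzF
    rwa [hzF, NNReal.abs_eq, NNReal.coe_le_coe] at hz
  have := hr.isProbabilityMeasure ht y
  exact hr.satisfiesLogSobolev_of_moment_ne_top hH ht hF hfF one_lt_two
    (ne_top_of_le_ne_top ENNReal.coe_ne_top
      (moment_le_rpow (ae_kernelMeasure_of_ae hFM t y) zero_le_two))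

theorem satisfiesLogSobolev_of_memLp [BorelSpace X] (hr : IsHeatKernel m r)
    (hH : DimFreeHarnack m r K) (ht : 0 < t) (hp : 1 < p)
    (hf : MemLp f (ENNReal.ofReal p) m) (h0 : 0 ≤ᵐ[m] f) : SatisfiesLogSobolev m r K t f := by
  cases isEmpty_or_nonempty X
  · exact .of_isEmpty
  have hp0 : 0 < p := one_pos.trans hp
  obtain ⟨F, hF, hfF⟩ := exists_measurable_nnreal_ae_eq hf.1 h0
  have hfin : ∫⁻ z, ((F z ^ p : ℝ≥0) : ℝ≥0∞) ∂m < ∞ := by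
    have hlt := (eLpNorm_lt_top_iff_lintegral_rpow_enorm_lt_top (ENNReal.ofReal_pos.2 hp0).ne'
      ENNReal.ofReal_ne_top).1 (memLp_congr_ae hfF |>.1 hf).2
    simpa only [ENNReal.toReal_ofReal hp0.le, NNReal.enorm_eq, ENNReal.coe_rpow_of_nonneg _ hp0.le]
      using hlt
  obtain ⟨y, hy⟩ := hr.exists_lintegral_ne_top ht (hF.pow_const p) hfin.ne
  simp only [ENNReal.coe_rpow_of_nonneg _ hp0.le] at hy
  exact hr.satisfiesLogSobolev_of_moment_ne_top hH ht hF hfF hp hy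

theorem exists_lipschitzWith_of_memLp_top (hr : IsHeatKernel m r) (hH : DimFreeHarnack m r K)
    (ht : 0 < t) (hf : MemLp f ∞ m) : ∃ L : ℝ≥0, LipschitzWith L (kernelFlow m r t f) := by
  cases isEmpty_or_nonempty X
  · exact ⟨0, fun x => isEmptyElim x⟩
  obtain ⟨M, hM⟩ := exists_ae_abs_le_of_memLp_top hf
  -- The shift by `M + 1` reduces to a function with values between two positive constants, whose
  -- logarithmic moments are bounded on the whole space.
  have hbounds : ∀ᵐ z ∂m, 1 ≤ f z + (M + 1) ∧ f z + (M + 1) ≤ 2 * M + 1 := hM.mono fun z hz => by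
    obtain ⟨hlow, hup⟩ := abs_le.1 hz
    constructor <;> linarith
  obtain ⟨F, hF, hfF⟩ : ∃ F : X → ℝ≥0, Measurable F ∧ (fun z => f z + (M + 1)) =ᵐ[m] fun z => F z :=
    exists_measurable_nnreal_ae_eq (hf.1.add aestronglyMeasurable_const)
      (hbounds.mono fun z hz => zero_le_one.trans hz.1)
  have hFbounds : ∀ᵐ z ∂m, 1 ≤ F z ∧ F z ≤ 2 * M + 1 := by
    filter_upwards [hbounds, hfF] with z hz hzF
    rw [hzF] at hz
    exact_mod_cast hz
  have hF1 := ae_kernelMeasure_of_ae (r := r) (hFbounds.mono fun z hz => hz.1) t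
  have hFC := ae_kernelMeasure_of_ae (r := r) (hFbounds.mono fun z hz => hz.2) t
  have hμ := hr.harnackFamily hH ht
  obtain ⟨L, hL⟩ :=
    hμ.exists_lipschitzWith_moment (hμ.hasFiniteMoment hF hF1 hFC one_lt_two) hF1 hFC
  rw [← hr.kernelFlow_coe_eq_moment ht hF, ← kernelFlow_congr hfF] at hL
  refine ⟨L, LipschitzWith.of_dist_le_mul fun x y => ?_⟩
  rw [← dist_add_right _ _ ((M : ℝ) + 1), ← hr.kernelFlow_add_const ht hf,
    ← hr.kernelFlow_add_const ht hf]
  exact hL.dist_le_mul x y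

end IsHeatKernel

end HeatFlow

end HeatMMS

theorem proposition3p2_general {X : Type*} [PseudoMetricSpace X] [MeasurableSpace X] [BorelSpace X]
    (m : Measure X) (r : ℝ → X → X → ℝ) (hr : IsHeatKernel m r)
    (K : ℝ) (hH : DimFreeHarnack m r K) (t : ℝ) (ht : 0 < t) :
    (∀ f : X → ℝ, MemLp f ∞ m → ∃ C : ℝ≥0, LipschitzWith C (kernelFlow m r t f)) ∧
    (∀ f : X → ℝ, MemLp f ∞ m → 0 ≤ᵐ[m] f → ∀ x,
      ((lip (kernelFlow m r t f) x ^ 2 : ℝ≥0∞) : EReal) ≤ (logSobolevBound m r K t f x : ℝ)) ∧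
    (∀ p : ℝ, 1 < p → ∀ f : X → ℝ, MemLp f (ENNReal.ofReal p) m → 0 ≤ᵐ[m] f →
      (∀ᵐ x ∂m, Integrable (fun y => f y * r t x y) m ∧
        Integrable (fun y => f y * Real.log (f y) * r t x y) m) ∧
      IsMinimalWeakUpperGradient m (kernelFlow m r t f)
        (minWeakUpperGradient m (kernelFlow m r t f)) ∧
      ∀ᵐ x ∂m, ((minWeakUpperGradient m (kernelFlow m r t f) x ^ 2 : ℝ≥0∞) : EReal) ≤
        (logSobolevBound m r K t f x : ℝ)) := by
  have := hr.sigmaFinite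
  refine ⟨fun f hf => hr.exists_lipschitzWith_of_memLp_top hH ht hf,
    fun f hf h0 => (hr.satisfiesLogSobolev_of_memLp_top hH ht hf h0).lip_sq_le,
    fun p hp f hf h0 => ?_⟩
  have hsob := hr.satisfiesLogSobolev_of_memLp hH ht hp hf h0
  exact ⟨Eventually.of_forall fun x => ⟨hsob.integrable x, hsob.integrable_mul_log x⟩,
    hsob.isWeakUpperGradient_lip.isMinimalWeakUpperGradient_minWeakUpperGradient,
    hsob.minWeakUpperGradient_sq_le⟩

theorem proposition3p2 {X : Type*} [MetricSpace X] [CompleteSpace X] [SecondCountableTopology X]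
    [MeasurableSpace X] [BorelSpace X] (m : Measure X)
    (hm : ∀ s : Set X, Bornology.IsBounded s → m s < ∞)
    (r : ℝ → X → X → ℝ) (hr : IsHeatKernel m r)
    (K : ℝ) (hH : DimFreeHarnack m r K) (t : ℝ) (ht : 0 < t) :
    (∀ f : X → ℝ, MemLp f ∞ m → ∃ C : ℝ≥0, LipschitzWith C (kernelFlow m r t f)) ∧
    (∀ f : X → ℝ, MemLp f ∞ m → 0 ≤ᵐ[m] f → ∀ x,
      ((lip (kernelFlow m r t f) x ^ 2 : ℝ≥0∞) : EReal) ≤ (logSobolevBound m r K t f x : ℝ)) ∧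
    (∀ p : ℝ, 1 < p → ∀ f : X → ℝ, MemLp f (ENNReal.ofReal p) m → 0 ≤ᵐ[m] f →
      (∀ᵐ x ∂m, Integrable (fun y => f y * r t x y) m ∧
        Integrable (fun y => f y * Real.log (f y) * r t x y) m) ∧
      IsMinimalWeakUpperGradient m (kernelFlow m r t f)
        (minWeakUpperGradient m (kernelFlow m r t f)) ∧
      ∀ᵐ x ∂m, ((minWeakUpperGradient m (kernelFlow m r t f) x ^ 2 : ℝ≥0∞) : EReal) ≤
        (logSobolevBound m r K t f x : ℝ)) :=
  proposition3p2_general m r hr K hH t ht
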